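/- Let $n\ge 1$ be an integer. For $m\ge 1$, a function $f:[-1,1]\to\mathbb R$ is called $m$-convex if its divided difference satisfies $[x_1,\dots,x_{m+2};f]\ge 0$ for all distinct $x_1,\dots,x_{m+2}\in[-1,1]$, where $[x_1;f]=f(x_1)$ and $$[x_1,\dots,x_{k+1};f]=\frac{[x_2,\dots,x_{k+1};f]-[x_1,\dots,x_k;f]}{x_{k+1}-x_1}.$$ Let $P_k(x)=\frac{1}{2^k k!}\frac{d^k}{dx^k}(x^2-1)^k$ be the Legendre polynomials, and define the following quadratures. - Gauss–Legendre, $k\ge 1$: $\displaystyle \mathcal G_k(f)=\sum_{x:\,P_k(x)=0}\frac{2(1-x^2)}{(k+1)^2P_{k+1}(x)^2}\,f(x)$. - Lobatto, $k\ge 2$: $\displaystyle \mathrm{Lob}_k(f)=\frac{2}{k(k-1)}\bigl(f(-1)+f(1)\bigr)+\sum_{x:\,P_{k-1}'(x)=0}\frac{2}{k(k-1)P_{k-1}(x)^2}\,f(x)$ (so $\mathrm{Lob}_2(f)=f(-1)+f(1)$). - Left Radau, $k\ge 2$: $\displaystyle \mathrm{Rad}^l_k(f)=\frac{2}{k^2}f(-1)+\sum_{x:\,Q_{k-1}(x)=0}\frac{1}{(1-x)P_{k-1}'(x)^2}\,f(x)$,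 where $Q_{k-1}(x)=\frac{P_{k-1}(x)+P_k(x)}{x+1}$. - Right Radau, $k\ge 2$: $\mathrm{Rad}^r_k(f)=\mathrm{Rad}^l_k\bigl(f(-\,\cdot\,)\bigr)$. If $f:[-1,1]\to\mathbb R$ is $(2n-1)$-convex, then $f$ is integrable on $[-1,1]$ and $$\mathcal G_n(f)\le\int_{-1}^1 f(x)\,dx\le \mathrm{Lob}_{n+1}(f).$$ If $f:[-1,1]\to\mathbb R$ is $2n$-convex, then $f$ is integrable on $[-1,1]$ and $$\mathrm{Rad}^l_{n+1}(f)\le\int_{-1}^1 f(x)\,dx\le \mathrm{Rad}^r_{n+1}(f).$$ -/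

import Mathlib

namespace Quadrature

open Polynomial

/-- The divided difference `[x 0, ..., x k; f]`, defined by the usual recursion
`[x₀; f] = f x₀` and
`[x₀, ..., x_{k+1}; f] = ([x₁, ..., x_{k+1}; f] - [x₀, ..., x_k; f]) / (x_{k+1} - x₀)`. -/
noncomputable def dividedDiff (f : ℝ → ℝ) : (k : ℕ) → (Fin (k + 1) → ℝ) → ℝ
  | 0, x => f (x 0)
  | k + 1, x =>
      (dividedDiff f k (fun i => x i.succ) - dividedDiff f k (fun i => x i.castSucc)) /
        (x (Fin.last (k + 1)) - x 0)

/-- `f` is `n`-convex on `s` (Popoviciu's convention, in which `1`-convex means convex):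
all divided differences of `f` at `n + 2` distinct points of `s` are nonnegative. -/
def IsNConvexOn (n : ℕ) (s : Set ℝ) (f : ℝ → ℝ) : Prop :=
  ∀ x : Fin (n + 2) → ℝ, Function.Injective x → (∀ i, x i ∈ s) → 0 ≤ dividedDiff f (n + 1) x

/-- The Legendre polynomial `P n`, by Rodrigues' formula. -/
noncomputable def legendreP (n : ℕ) : ℝ[X] :=
  C (1 / (2 ^ n * (n.factorial : ℝ))) * derivative^[n] ((X ^ 2 - 1) ^ n)

/-- The `n`-point Gauss-Legendre quadrature on `[-1, 1]` (for `n ≥ 1`). -/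
noncomputable def gauss (n : ℕ) (f : ℝ → ℝ) : ℝ :=
  ∑ x ∈ (legendreP n).roots.toFinset,
    2 * (1 - x ^ 2) / (((n : ℝ) + 1) ^ 2 * (legendreP (n + 1)).eval x ^ 2) * f x

/-- The `n`-point Lobatto quadrature on `[-1, 1]` (for `n ≥ 2`). For `n = 2` the derivative of
`P 1` is the constant `1`, so the sum is empty and the value is `f (-1) + f 1`. -/
noncomputable def lobatto (n : ℕ) (f : ℝ → ℝ) : ℝ :=
  2 / ((n : ℝ) * ((n : ℝ) - 1)) * f (-1) + 2 / ((n : ℝ) * ((n : ℝ) - 1)) * f 1 +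
    ∑ x ∈ (derivative (legendreP (n - 1))).roots.toFinset,
      2 / ((n : ℝ) * ((n : ℝ) - 1) * (legendreP (n - 1)).eval x ^ 2) * f x

/-- The polynomial `(P (n-1) + P n) / (X + 1)`, whose roots are the interior nodes of the
`n`-point Radau quadrature (the division is exact, since `P k` takes the value `(-1) ^ k`
at `-1`). -/
noncomputable def radauPoly (n : ℕ) : ℝ[X] :=
  (legendreP (n - 1) + legendreP n) / (X + 1)

/-- The `n`-point left Radau quadrature on `[-1, 1]` (for `n ≥ 2`). -/
noncomputable def radauLeft (n : ℕ) (f : ℝ → ℝ) : ℝ :=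
  2 / (n : ℝ) ^ 2 * f (-1) +
    ∑ x ∈ (radauPoly n).roots.toFinset,
      1 / ((1 - x) * (derivative (legendreP (n - 1))).eval x ^ 2) * f x

/-- The `n`-point right Radau quadrature: the left one applied to `x ↦ f (-x)`. -/
noncomputable def radauRight (n : ℕ) (f : ℝ → ℝ) : ℝ :=
  radauLeft n (fun x => f (-x))

end Quadrature

namespace Quadrature

open Polynomial Filter Topology

/-! Suppose a rule has end nodes `E ⊆ {-1, 1}` and interior nodes `I`, and is exact in degree at
most `m = #E + 2 #I - 1`. If the polynomial `p` interpolates `f` on `E` and doubly on `I`, then the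
rule gives `∫ p` when applied to `f`. The error `f - p` is a divided difference of order `m + 1`,
nonnegative by convexity, times `∏ (x - e) ∏ (x - i)²`, so the sign of `∏ (x - e)` alone decides
which side of the integral the rule lies on. Gauss, Lobatto and left Radau are the cases `E = ∅`,
`{-1, 1}`, `{-1}`; right Radau follows by reflection.

As `f` is not assumed differentiable, each double node `i` is split into `i` and `i + ε`. The sign
can then fail only on the intervals `(i, i + ε)`. There the error has a bound independent of ε,
because divided differences of order `m` are monotone in every node and hence bounded when the nodes
other than `±1` stay in a compact part of `(-1, 1)`. The loss is `O(ε)`, and ε tends to 0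
(`IsNConvexOn.quadrature_le`). The same monotonicity gives integrability.

Exactness with the explicit weights comes from orthogonality: `P_n`, `P_n'` and the Radau polynomial
are orthogonal to lower degrees for the weights `1`, `1 - x²`, `1 + x`, so their roots are simple
and lie in `(-1, 1)`. Each weight is then checked on one test polynomial, integrated by parts
(`polyIntegral_eq_sum`). -/

/-! ### Differential identities for Legendre polynomials -/

/-- With `u = (X² - 1)^n`, differentiate `(X² - 1) u' = 2nXu` a total of `j + 1` times. The case `j
= n - 1`, where the middle coefficient vanishes, leads to Legendre's equation. -/
theorem X_sq_sub_one_mul_iterate_derivative (n j : ℕ) :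
    (X ^ 2 - 1 : ℝ[X]) * derivative^[j + 2] ((X ^ 2 - 1) ^ n) =
      C (2 * (n : ℝ) - 2 * j - 2) * X * derivative^[j + 1] ((X ^ 2 - 1) ^ n) +
        C (((j : ℝ) + 1) * (2 * n - j)) * derivative^[j] ((X ^ 2 - 1) ^ n) := by
  have h0 : (X ^ 2 - 1 : ℝ[X]) * derivative ((X ^ 2 - 1) ^ n) =
      C (2 * n : ℝ) * X * (X ^ 2 - 1) ^ n := by
    rcases n with _ | n
    · simp
    · simp [derivative_pow]
      ring
  induction j with
  | zero =>
    have h := congrArg derivative h0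
    simp only [derivative_mul, derivative_sub, derivative_X_pow, derivative_one, derivative_C,
      derivative_X] at h
    simp only [Function.iterate_succ, Function.iterate_zero, Function.comp_apply, id]
    simp only [map_sub, map_mul, map_add, map_natCast, map_ofNat, map_one] at h ⊢
    push_cast at h ⊢
    linear_combination h
  | succ j ih =>
    have h := congrArg derivative ih
    simp only [derivative_mul, derivative_sub, derivative_X_pow, derivative_one, derivative_C,
      derivative_X, derivative_add, ← Function.iterate_succ_apply'] at h
    simp only [map_sub, map_mul, map_add, map_natCast, map_ofNat, map_one] at h ⊢
    push_cast [map_sub, map_mul, map_add, map_natCast, map_ofNat, map_one, map_zero] at h ⊢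
    linear_combination h

/-- Leibniz's rule: only the first three derivatives of `X² - 1`, counting order zero, are nonzero.
-/
theorem iterate_derivative_X_sq_sub_one_mul (v : ℝ[X]) (k : ℕ) :
    derivative^[k + 2] ((X ^ 2 - 1) * v) =
      (X ^ 2 - 1) * derivative^[k + 2] v + C (2 * (k + 2 : ℝ)) * X * derivative^[k + 1] v +
        C ((k + 2) * (k + 1) : ℝ) * derivative^[k] v := by
  induction k with
  | zero =>
    simp only [Function.iterate_succ, Function.iterate_zero, Function.comp_apply, id,
      derivative_mul, derivative_sub, derivative_X_pow, derivative_one, derivative_add,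
      derivative_C]
    simp only [map_mul, map_add, map_natCast, map_ofNat, map_one, map_zero]
    push_cast
    simp
    ring
  | succ k ih =>
    rw [Function.iterate_succ_apply', ih]
    simp only [derivative_mul, derivative_sub, derivative_X_pow, derivative_one, derivative_C,
      derivative_X, derivative_add, ← Function.iterate_succ_apply']
    simp only [map_mul, map_add, map_natCast, map_ofNat, map_one]
    push_cast
    simp
    ring

@[simp] theorem legendreP_zero : legendreP 0 = 1 := by
  simp [legendreP]

theorem legendreP_one : legendreP 1 = X := by
  simp only [legendreP, pow_one, Nat.factorial_one, Function.iterate_one, derivative_sub,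
    derivative_X_pow, derivative_one]
  simp [← mul_assoc, ← C_mul]

theorem X_sq_sub_one_mul_derivative_legendreP (n : ℕ) :
    (X ^ 2 - 1) * derivative (legendreP n) =
      C (n + 1 : ℝ) * (legendreP (n + 1) - X * legendreP n) := by
  rcases n with _ | k
  · simp [legendreP_one]
  · have h1 := X_sq_sub_one_mul_iterate_derivative (k + 1) k
    have h2 := iterate_derivative_X_sq_sub_one_mul ((X ^ 2 - 1) ^ (k + 1)) k
    rw [← pow_succ'] at h2
    simp only [legendreP, derivative_C_mul, ← Function.iterate_succ_apply']
    rw [h2]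
    -- The middle coefficient of `h1` vanishes and its last one equals that of `h2`, so the `k`-th
    -- derivative, which is no Legendre polynomial, can be eliminated.
    have e1 : (2 * ((k + 1 : ℕ) : ℝ) - 2 * k - 2) = 0 := by push_cast; ring
    have e2 : (((k : ℝ) + 1) * (2 * ((k + 1 : ℕ) : ℝ) - k)) = (k + 2) * (k + 1) := by
      push_cast; ring
    rw [e1, e2] at h1
    simp only [map_zero, zero_mul, zero_add] at h1
    rw [← h1]
    set c : ℝ := 1 / (2 ^ (k + 1) * ((k + 1).factorial : ℝ)) with hc
    have hk : ((k : ℝ) + 2) ≠ 0 := by positivity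
    have e3 : (1 / (2 ^ (k + 1 + 1) * ((k + 1 + 1).factorial : ℝ)) : ℝ) = c / (2 * (k + 2)) := by
      rw [hc, Nat.factorial_succ (k + 1)]
      push_cast
      field_simp
      ring
    rw [e3]
    have e4 : C (2 * (k + 2) : ℝ) * C (c / (2 * (k + 2))) = C c := by
      rw [← C_mul]; congr 1; field_simp
    have e5 : (C (((k + 1 : ℕ) : ℝ) + 1) : ℝ[X]) * C (c / (2 * (k + 2))) * 2 = C c := by
      rw [← map_ofNat C, ← C_mul, ← C_mul]; congr 1; push_cast; field_simp; ring
    have e6 : (C (((k + 1 : ℕ) : ℝ) + 1) : ℝ[X]) * C (c / (2 * (k + 2))) * C (2 * (k + 2) : ℝ) =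
      (C (((k + 1 : ℕ) : ℝ) + 1) : ℝ[X]) * C c := by
      rw [mul_assoc, mul_comm (C (c / _)), e4]
    linear_combination
      (-(X ^ 2 - 1) * derivative^[k + 2] ((X ^ 2 - 1) ^ (k + 1) : ℝ[X])) * e5 -
      (X * derivative^[k + 1] ((X ^ 2 - 1) ^ (k + 1) : ℝ[X])) * e6

theorem derivative_X_sq_sub_one_mul_derivative_legendreP (n : ℕ) :
    derivative ((X ^ 2 - 1) * derivative (legendreP n)) = C (n * (n + 1) : ℝ) * legendreP n := by
  rcases n with _ | k
  · simp
  · have h1 := X_sq_sub_one_mul_iterate_derivative (k + 1) k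
    have e1 : (2 * ((k + 1 : ℕ) : ℝ) - 2 * k - 2) = 0 := by push_cast; ring
    have e2 : (((k : ℝ) + 1) * (2 * ((k + 1 : ℕ) : ℝ) - k)) =
        (k + 1 : ℕ) * ((k + 1 : ℕ) + 1) := by
      push_cast; ring
    rw [e1, e2] at h1
    simp only [map_zero, zero_mul, zero_add] at h1
    simp only [legendreP, derivative_C_mul, ← Function.iterate_succ_apply']
    rw [mul_left_comm, h1, derivative_C_mul, derivative_C_mul,
      ← Function.iterate_succ_apply' derivative]
    ring

/-- Differentiate the recurrence for `(X² - 1) P_n'`, compare with Legendre's equation, and cancel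
`n + 1`. -/
theorem derivative_legendreP_succ (n : ℕ) :
    derivative (legendreP (n + 1)) =
      C (n + 1 : ℝ) * legendreP n + X * derivative (legendreP n) := by
  have h1 := derivative_X_sq_sub_one_mul_derivative_legendreP n
  rw [X_sq_sub_one_mul_derivative_legendreP] at h1
  simp only [derivative_sub, derivative_mul, derivative_X, derivative_C] at h1
  have hn : (C (n + 1 : ℝ) : ℝ[X]) ≠ 0 := by
    rw [Ne, C_eq_zero]; positivity
  apply mul_left_cancel₀ hn
  simp only [map_add, map_mul, map_natCast, map_one] at h1 ⊢
  linear_combination h1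

theorem X_sq_sub_one_mul_derivative_legendreP_succ (n : ℕ) :
    (X ^ 2 - 1) * derivative (legendreP (n + 1)) =
      C (n + 1 : ℝ) * (X * legendreP (n + 1) - legendreP n) := by
  rw [derivative_legendreP_succ]
  linear_combination X * X_sq_sub_one_mul_derivative_legendreP n

theorem natDegree_legendreP_le (n : ℕ) : (legendreP n).natDegree ≤ n := by
  refine (natDegree_C_mul_le _ _).trans ((natDegree_iterate_derivative _ _).trans ?_)
  have : ((X ^ 2 - 1 : ℝ[X]) ^ n).natDegree ≤ n * 2 :=
    natDegree_pow_le_of_le n (by compute_degree)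
  omega

theorem coeff_legendreP_self_pos (n : ℕ) : 0 < (legendreP n).coeff n := by
  have hm : ((X ^ 2 - 1 : ℝ[X]) ^ n).coeff (n + n) = 1 := by
    have h : (X ^ 2 - 1 : ℝ[X]).Monic := by monicity!
    have hd : ((X ^ 2 - 1 : ℝ[X]) ^ n).natDegree = n + n := by
      rw [natDegree_pow, show (X ^ 2 - 1 : ℝ[X]).natDegree = 2 by compute_degree!]
      ring
    rw [← hd]
    exact h.pow n
  rw [legendreP, coeff_C_mul, coeff_iterate_derivative, hm]
  have : 0 < (n + n).descFactorial n := Nat.descFactorial_pos.2 (by omega)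
  simp only [nsmul_eq_mul, mul_one]
  positivity

theorem natDegree_legendreP (n : ℕ) : (legendreP n).natDegree = n :=
  natDegree_eq_of_le_of_coeff_ne_zero (natDegree_legendreP_le n) (coeff_legendreP_self_pos n).ne'

theorem legendreP_ne_zero (n : ℕ) : legendreP n ≠ 0 := fun h => by
  simpa [h] using coeff_legendreP_self_pos n

theorem eval_one_legendreP (n : ℕ) : (legendreP n).eval 1 = 1 := by
  induction n with
  | zero => simp
  | succ n ih =>
    have h := congrArg (eval 1) (X_sq_sub_one_mul_derivative_legendreP n)
    simp only [eval_mul, eval_sub, eval_pow, eval_X, eval_one, eval_C, ih] at h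
    have : (n + 1 : ℝ) ≠ 0 := by positivity
    have h2 : (n + 1 : ℝ) * (eval 1 (legendreP (n + 1)) - 1) = 0 := by linarith
    have := (mul_eq_zero.1 h2).resolve_left this
    linarith

theorem eval_neg_one_legendreP (n : ℕ) : (legendreP n).eval (-1) = (-1) ^ n := by
  induction n with
  | zero => simp
  | succ n ih =>
    have h := congrArg (eval (-1)) (X_sq_sub_one_mul_derivative_legendreP n)
    simp only [eval_mul, eval_sub, eval_pow, eval_X, eval_one, eval_C, ih] at h
    have : (n + 1 : ℝ) ≠ 0 := by positivity
    have h2 : (n + 1 : ℝ) * (eval (-1) (legendreP (n + 1)) + (-1) ^ n) = 0 := by linarith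
    have := (mul_eq_zero.1 h2).resolve_left this
    rw [pow_succ]
    linarith

theorem eval_one_derivative_legendreP (n : ℕ) :
    (derivative (legendreP n)).eval 1 = n * (n + 1) / 2 := by
  have h := congrArg (eval 1) (derivative_X_sq_sub_one_mul_derivative_legendreP n)
  simp [derivative_mul, eval_one_legendreP] at h
  linarith

theorem eval_neg_one_derivative_legendreP (n : ℕ) :
    (derivative (legendreP n)).eval (-1) = -(-1) ^ n * (n * (n + 1) / 2) := by
  have h := congrArg (eval (-1)) (derivative_X_sq_sub_one_mul_derivative_legendreP n)
  simp [derivative_mul, eval_neg_one_legendreP] at h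
  linarith

/-! ### Integration of polynomials and orthogonality -/

/-- The integral over `[-1, 1]` as a linear functional on polynomials. -/
noncomputable def polyIntegral : ℝ[X] →ₗ[ℝ] ℝ where
  toFun p := ∫ x in (-1 : ℝ)..1, p.eval x
  map_add' p q := by
    simp only [eval_add]
    exact intervalIntegral.integral_add (p.continuous.intervalIntegrable _ _)
      (q.continuous.intervalIntegrable _ _)
  map_smul' c p := by simp

theorem polyIntegral_apply (p : ℝ[X]) : polyIntegral p = ∫ x in (-1 : ℝ)..1, p.eval x := rfl

theorem polyIntegral_C_mul (c : ℝ) (p : ℝ[X]) : polyIntegral (C c * p) = c * polyIntegral p := by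
  rw [← smul_eq_C_mul, map_smul, smul_eq_mul]

theorem polyIntegral_derivative (p : ℝ[X]) :
    polyIntegral (derivative p) = p.eval 1 - p.eval (-1) :=
  intervalIntegral.integral_eq_sub_of_hasDerivAt (fun x _ => p.hasDerivAt x)
    ((derivative p).continuous.intervalIntegrable _ _)

theorem polyIntegral_pos {p : ℝ[X]} (hp : p ≠ 0)
    (h : ∀ x ∈ Set.Icc (-1 : ℝ) 1, 0 ≤ p.eval x) : 0 < polyIntegral p := by
  obtain ⟨c, hc, hpc⟩ : ∃ c ∈ Set.Icc (-1 : ℝ) 1, p.eval c ≠ 0 := by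
    by_contra! hcon
    refine hp (p.eq_zero_of_infinite_isRoot ((Set.Icc_infinite (by norm_num)).mono hcon))
  exact intervalIntegral.integral_pos (by norm_num) p.continuous.continuousOn
    (fun x hx => h x (Set.Ioc_subset_Icc_self hx)) ⟨c, hc, (h c hc).lt_of_ne' hpc⟩

/-- The operator `L g = ((x² - 1) g')'` is symmetric and `L P_n = n(n+1) P_n`, while `L x^k` is
`k(k+1) x^k` plus a multiple of `x^(k-2)`, killed by induction. Since `n(n+1) ≠ k(k+1)`, the
integral vanishes. -/
theorem polyIntegral_legendreP_mul_X_pow (n k : ℕ) (hk : k < n) :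
    polyIntegral (legendreP n * X ^ k) = 0 := by
  induction k using Nat.strong_induction_on with
  | _ k ih =>
    set A := (X ^ 2 - 1) * derivative (legendreP n) with hA
    set B : ℝ[X] := (X ^ 2 - 1) * derivative (X ^ k) with hB
    have h1 := polyIntegral_derivative (A * X ^ k)
    have h2 := polyIntegral_derivative (legendreP n * B)
    have hz1 : eval 1 (A * X ^ k) - eval (-1) (A * X ^ k) = 0 := by simp [hA]
    have hz2 : eval 1 (legendreP n * B) - eval (-1) (legendreP n * B) = 0 := by simp [hB]
    rw [hz1, derivative_mul, derivative_X_sq_sub_one_mul_derivative_legendreP, map_add, mul_assoc,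
      polyIntegral_C_mul] at h1
    rw [hz2, derivative_mul, map_add] at h2
    have h3 : A * derivative (X ^ k) = derivative (legendreP n) * B := by rw [hA, hB]; ring
    rw [h3] at h1
    have hBd : polyIntegral (legendreP n * derivative B) =
        k * (k + 1) * polyIntegral (legendreP n * X ^ k) := by
      match k, hk, ih, hB with
      | 0, _, _, hB => simp [hB]
      | 1, _, _, hB =>
        have : derivative B = C 2 * X := by simp [hB, map_ofNat]; norm_num
        rw [this, mul_left_comm, polyIntegral_C_mul]; norm_num
      | k + 2, hk, ih, hB =>
        have : derivative B = C ((k + 2) * (k + 3) : ℝ) * X ^ (k + 2)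
            - C ((k + 2) * (k + 1) : ℝ) * X ^ k := by
          simp [hB, map_ofNat]; ring
        rw [this, mul_sub, map_sub, mul_left_comm, polyIntegral_C_mul, mul_left_comm,
          polyIntegral_C_mul, ih k (by omega) (by omega)]
        push_cast; ring
    have hlt : (k : ℝ) < n := by exact_mod_cast hk
    have h4 : ((n : ℝ) * (n + 1) - k * (k + 1)) * polyIntegral (legendreP n * X ^ k) = 0 := by
      linarith
    refine (mul_eq_zero.1 h4).resolve_left (ne_of_gt ?_)
    have : (0 : ℝ) ≤ k := by positivity
    nlinarith

theorem polyIntegral_legendreP_mul (n : ℕ) (r : ℝ[X]) (hr : r.degree < n) :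
    polyIntegral (legendreP n * r) = 0 := by
  rw [r.as_sum_support_C_mul_X_pow, Finset.mul_sum, map_sum]
  refine Finset.sum_eq_zero fun k hk => ?_
  rw [mul_left_comm, polyIntegral_C_mul, polyIntegral_legendreP_mul_X_pow, mul_zero]
  exact_mod_cast (le_degree_of_mem_supp k hk).trans_lt hr

/-! ### Zeros of orthogonal polynomials -/

/-- If `q = g h`, then `w q h = w g h²` is nonnegative and nonzero, so its integral is positive; but
`h` has smaller degree than `q`. -/
theorem not_dvd_of_orthogonal {w q g : ℝ[X]} (hq : q ≠ 0) (hw0 : w ≠ 0)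
    (hw : ∀ x ∈ Set.Icc (-1 : ℝ) 1, 0 ≤ w.eval x)
    (horth : ∀ r : ℝ[X], r.degree < q.natDegree → polyIntegral (w * q * r) = 0)
    (hg : 0 < g.natDegree) (hg0 : ∀ x ∈ Set.Icc (-1 : ℝ) 1, 0 ≤ g.eval x) : ¬ g ∣ q := by
  rintro ⟨h, rfl⟩
  have hg' : g ≠ 0 := left_ne_zero_of_mul hq
  have hh : h ≠ 0 := right_ne_zero_of_mul hq
  have h1 := horth h (by
    rw [natDegree_mul hg' hh, degree_eq_natDegree hh]
    exact_mod_cast (by omega : h.natDegree < g.natDegree + h.natDegree))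
  refine (polyIntegral_pos (mul_ne_zero (mul_ne_zero hw0 hq) hh) fun x hx => ?_).ne' h1
  simp only [eval_mul]
  nlinarith [mul_nonneg (mul_nonneg (hw x hx) (hg0 x hx)) (mul_self_nonneg (h.eval x))]

theorem nonneg_or_nonpos_of_roots_eq_zero {g : ℝ[X]} (hg : g ≠ 0) (h : g.roots = 0) :
    (∀ x, 0 ≤ g.eval x) ∨ ∀ x, 0 ≤ (-g).eval x := by
  by_contra! hcon
  obtain ⟨⟨a, ha⟩, b, hb⟩ := hcon
  rw [eval_neg, neg_lt_zero] at hb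
  obtain ⟨c, hc⟩ := mem_range_of_exists_le_of_exists_ge g.continuous ⟨a, ha.le⟩ ⟨b, hb.le⟩
  have : c ∈ g.roots := (mem_roots hg).2 hc
  simp [h] at this

/-- Divisors of constant sign are constant. Applied to `X - a` with `a` outside `(-1, 1)`, to `(X -
a)²`, and to the rootless cofactor of `q`, this locates, separates and counts the roots. -/
theorem natDegree_eq_zero_of_dvd_of_orthogonal {w q g : ℝ[X]} (hq : q ≠ 0) (hw0 : w ≠ 0)
    (hw : ∀ x ∈ Set.Icc (-1 : ℝ) 1, 0 ≤ w.eval x)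
    (horth : ∀ r : ℝ[X], r.degree < q.natDegree → polyIntegral (w * q * r) = 0)
    (hgq : g ∣ q) (hg0 : (∀ x ∈ Set.Icc (-1 : ℝ) 1, 0 ≤ g.eval x) ∨
      ∀ x ∈ Set.Icc (-1 : ℝ) 1, 0 ≤ (-g).eval x) : g.natDegree = 0 := by
  by_contra hd
  rcases hg0 with hg0 | hg0
  · exact not_dvd_of_orthogonal hq hw0 hw horth (Nat.pos_of_ne_zero hd) hg0 hgq
  · exact not_dvd_of_orthogonal hq hw0 hw horth (by rw [natDegree_neg]; omega) hg0
      (neg_dvd.2 hgq)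

/-- The roots of an orthogonal polynomial lie in `(-1, 1)`. -/
theorem mem_Ioo_of_orthogonal {w q : ℝ[X]} (hq : q ≠ 0) (hw0 : w ≠ 0)
    (hw : ∀ x ∈ Set.Icc (-1 : ℝ) 1, 0 ≤ w.eval x)
    (horth : ∀ r : ℝ[X], r.degree < q.natDegree → polyIntegral (w * q * r) = 0)
    {a : ℝ} (ha : q.IsRoot a) : a ∈ Set.Ioo (-1 : ℝ) 1 := by
  by_contra hcon
  have := natDegree_eq_zero_of_dvd_of_orthogonal hq hw0 hw horth (dvd_iff_isRoot.2 ha) (by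
    rcases le_or_gt a (-1) with h | h
    · left
      intro x hx
      simp only [eval_sub, eval_X, eval_C]
      linarith [hx.1]
    · right
      have h1 : 1 ≤ a := by
        by_contra h1
        exact hcon ⟨h, not_le.1 h1⟩
      intro x hx
      simp only [eval_neg, eval_sub, eval_X, eval_C]
      linarith [hx.2])
  simp at this

/-- An orthogonal polynomial has as many distinct real roots as its degree. -/
theorem card_roots_of_orthogonal {w q : ℝ[X]} (hq : q ≠ 0) (hw0 : w ≠ 0)
    (hw : ∀ x ∈ Set.Icc (-1 : ℝ) 1, 0 ≤ w.eval x)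
    (horth : ∀ r : ℝ[X], r.degree < q.natDegree → polyIntegral (w * q * r) = 0) :
    q.roots.toFinset.card = q.natDegree := by
  have hnd : q.roots.Nodup := by
    rw [Multiset.nodup_iff_count_le_one]
    intro a
    rw [count_roots]
    by_contra! hlt
    have h1 : (X - C a) ^ 2 ∣ q := (le_rootMultiplicity_iff hq).1 hlt
    have := natDegree_eq_zero_of_dvd_of_orthogonal hq hw0 hw horth h1 (Or.inl fun x _ => by
      simp only [eval_pow]; positivity)
    simp at this
  rw [Multiset.toFinset_card_of_nodup hnd]
  obtain ⟨g, hg, hdeg, hroots⟩ := exists_prod_multiset_X_sub_C_mul q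
  have hg0 : g ≠ 0 := right_ne_zero_of_mul (hg ▸ hq)
  have := natDegree_eq_zero_of_dvd_of_orthogonal hq hw0 hw horth (Dvd.intro_left _ hg)
    ((nonneg_or_nonpos_of_roots_eq_zero hg0 hroots).imp (fun h x _ => h x) (fun h x _ => h x))
  omega

/-! ### Exactness criterion for a quadrature -/

/-- The monic polynomial with simple roots at the points of `s`. -/
noncomputable abbrev nodePoly (s : Finset ℝ) : ℝ[X] := Lagrange.nodal s id

theorem nodup_roots_of_card {q : ℝ[X]} (h : q.roots.toFinset.card = q.natDegree) :
    q.roots.Nodup := by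
  have h1 : q.roots.toFinset.card ≤ q.roots.card := Multiset.toFinset_card_le _
  have h2 := q.card_roots'
  exact Multiset.toFinset_card_eq_card_iff_nodup.1 (by omega)

theorem eq_C_mul_nodePoly {q : ℝ[X]} (h : q.roots.toFinset.card = q.natDegree) :
    q = C q.leadingCoeff * nodePoly q.roots.toFinset := by
  have h1 : q.roots.toFinset.card ≤ q.roots.card := Multiset.toFinset_card_le _
  have h2 := q.card_roots'
  have hnd := nodup_roots_of_card h
  have h3 := C_leadingCoeff_mul_prod_multiset_X_sub_C (p := q) (by omega)
  conv_lhs => rw [← h3]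
  congr 1
  rw [nodePoly, Lagrange.nodal, Finset.prod, Multiset.toFinset_val, Multiset.dedup_eq_self.2 hnd]
  rfl

theorem nodePoly_dvd {s : Finset ℝ} {p : ℝ[X]} (h : ∀ a ∈ s, p.eval a = 0) : nodePoly s ∣ p := by
  refine Finset.prod_dvd_of_coprime (fun a _ b _ hab => ?_) fun a ha => dvd_iff_isRoot.2 (h a ha)
  exact isCoprime_X_sub_C_of_isUnit_sub (sub_ne_zero.2 hab).isUnit

/-- A quadrature whose node polynomial is orthogonal to all polynomials of degree less than `d`,
and whose weights are right on one test polynomial for every node, is exact up to the expected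
degree. -/
theorem polyIntegral_eq_sum (T : Finset ℝ) (d : ℕ) (w : ℝ → ℝ)
    (horth : ∀ r : ℝ[X], r.degree < d → polyIntegral (nodePoly T * r) = 0)
    (htest : ∀ a ∈ T, ∃ F : ℝ[X], F.degree < (T.card + d : ℕ) ∧ F.eval a ≠ 0 ∧
      (∀ b ∈ T, b ≠ a → F.eval b = 0) ∧ polyIntegral F = w a * F.eval a)
    (p : ℝ[X]) (hp : p.degree < (T.card + d : ℕ)) :
    polyIntegral p = ∑ a ∈ T, w a * p.eval a := by
  choose! F hFd hFa hFb hFJ using htest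
  -- Subtracting multiples of the test polynomials makes `g` vanish on `T`. The node polynomial then
  -- divides it with a quotient of degree less than `d`, so orthogonality kills its integral.
  set g := p - ∑ a ∈ T, C (p.eval a / (F a).eval a) * F a with hg
  have hgd : g.degree < (T.card + d : ℕ) := by
    rw [← mem_degreeLT] at hp ⊢
    refine Submodule.sub_mem _ hp (Submodule.sum_mem _ fun a ha => ?_)
    rw [← smul_eq_C_mul]
    exact Submodule.smul_mem _ _ (mem_degreeLT.2 (hFd a ha))
  have hg0 : ∀ a ∈ T, g.eval a = 0 := by
    intro a ha
    rw [hg, eval_sub, eval_finsetSum, Finset.sum_eq_single_of_mem a ha]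
    · rw [eval_mul, eval_C, div_mul_cancel₀ _ (hFa a ha), sub_self]
    · intro b hb hba
      rw [eval_mul, hFb b hb a ha hba.symm, mul_zero]
  obtain ⟨r, hr⟩ := nodePoly_dvd hg0
  have hJ : polyIntegral g = 0 := by
    rw [hr]
    apply horth
    rcases eq_or_ne r 0 with h0 | h0
    · rw [h0, degree_zero]; exact WithBot.bot_lt_coe _
    have hN : (nodePoly T) ≠ 0 := Lagrange.nodal_ne_zero
    rw [hr, degree_eq_natDegree (mul_ne_zero hN h0), natDegree_mul hN h0,
      Lagrange.natDegree_nodal] at hgd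
    rw [degree_eq_natDegree h0]
    have : T.card + r.natDegree < T.card + d := by exact_mod_cast hgd
    exact_mod_cast (by omega : r.natDegree < d)
  rw [hg, map_sub, map_sum, sub_eq_zero] at hJ
  rw [hJ]
  refine Finset.sum_congr rfl fun a ha => ?_
  rw [polyIntegral_C_mul, hFJ a ha]
  field_simp [hFa a ha]

theorem eval_derivative_ne_zero_of_card {q : ℝ[X]} (hq : q ≠ 0)
    (h : q.roots.toFinset.card = q.natDegree) {a : ℝ} (ha : q.IsRoot a) :
    (derivative q).eval a ≠ 0 := fun h0 => by
  have h1 := (one_lt_rootMultiplicity_iff_isRoot hq).2 ⟨ha, h0⟩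
  have h2 := Multiset.nodup_iff_count_le_one.1 (nodup_roots_of_card h) a
  rw [count_roots] at h2
  omega

theorem eval_derivative_X_sub_C_mul (v : ℝ[X]) (z : ℝ) :
    (derivative ((X - C z) * v)).eval z = v.eval z := by
  simp [derivative_mul]

theorem eval_eq_zero_of_X_sub_C_mul {q v : ℝ[X]} {z b : ℝ} (h : q = (X - C z) * v)
    (hb : q.IsRoot b) (hbz : b ≠ z) : v.eval b = 0 := by
  rw [IsRoot, h, eval_mul, eval_sub, eval_X, eval_C] at hb
  exact (mul_eq_zero.1 hb).resolve_left (sub_ne_zero.2 hbz)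

theorem natDegree_of_eq_X_sub_C_mul {q v : ℝ[X]} {z : ℝ} (hq : q ≠ 0) (h : q = (X - C z) * v) :
    q.natDegree = v.natDegree + 1 := by
  have hv : v ≠ 0 := by rintro rfl; simp [h] at hq
  rw [h, natDegree_mul (X_sub_C_ne_zero z) hv, natDegree_X_sub_C, add_comm]

theorem degree_lt_of_natDegree_lt' {p : ℝ[X]} {d : ℕ} (h : p.natDegree < d) : p.degree < d :=
  degree_le_natDegree.trans_lt (by exact_mod_cast h)

theorem degree_derivative_lt_of_natDegree_le {p : ℝ[X]} {d : ℕ} (h : p.natDegree ≤ d) :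
    (derivative p).degree < d := by
  rcases eq_or_ne p 0 with rfl | hp
  · simp
  · exact (degree_derivative_lt hp).trans_le (degree_le_of_natDegree_le h)

theorem degree_mul_lt {p r : ℝ[X]} {k d e : ℕ} (hp : p.natDegree ≤ k) (hr : r.degree < d)
    (he : k + d ≤ e) : (p * r).degree < e := by
  rcases eq_or_ne r 0 with rfl | h0
  · simp
  · rw [degree_eq_natDegree h0] at hr
    have hr' : r.natDegree < d := by exact_mod_cast hr
    refine degree_lt_of_natDegree_lt' (natDegree_mul_le.trans_lt ?_)
    omega

/-- Since `S = (X - z) v`, the derivative of `S v` is `v² + 2 S v'`; orthogonality removes the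
second term and only boundary values remain. This evaluates the test polynomials at the Gauss nodes
and the interior Radau nodes. -/
theorem polyIntegral_sq_of_orthogonal {S v : ℝ[X]} {z : ℝ} (hz : z ∈ Set.Ioo (-1 : ℝ) 1)
    (hS : S = (X - C z) * v) (h : polyIntegral (S * derivative v) = 0) :
    polyIntegral (v ^ 2) = S.eval 1 ^ 2 / (1 - z) + S.eval (-1) ^ 2 / (1 + z) := by
  have h1 := polyIntegral_derivative (S * v)
  have h2 : derivative (S * v) = v ^ 2 + C 2 * (S * derivative v) := by
    rw [hS, map_ofNat]
    simp only [derivative_mul, derivative_sub, derivative_X, derivative_C]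
    ring
  rw [h2, map_add, polyIntegral_C_mul, h, mul_zero, add_zero] at h1
  rw [h1, hS]
  simp only [eval_mul, eval_sub, eval_X, eval_C]
  have hz1 : (1 : ℝ) - z ≠ 0 := by linarith [hz.2]
  have hz2 : (1 : ℝ) + z ≠ 0 := by linarith [hz.1]
  field_simp
  ring

/-! ### Exactness of Gauss–Legendre quadrature -/

section Gauss

theorem legendreP_orthogonal (n : ℕ) (r : ℝ[X]) (hr : r.degree < (legendreP n).natDegree) :
    polyIntegral (1 * legendreP n * r) = 0 := by
  rw [one_mul]
  exact polyIntegral_legendreP_mul n r (natDegree_legendreP n ▸ hr)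

theorem card_roots_legendreP (n : ℕ) : (legendreP n).roots.toFinset.card = n :=
  (card_roots_of_orthogonal (legendreP_ne_zero n) one_ne_zero (by simp)
    (legendreP_orthogonal n)).trans (natDegree_legendreP n)

theorem mem_Ioo_of_isRoot_legendreP {n : ℕ} {a : ℝ} (ha : (legendreP n).IsRoot a) :
    a ∈ Set.Ioo (-1 : ℝ) 1 :=
  mem_Ioo_of_orthogonal (legendreP_ne_zero n) one_ne_zero (by simp) (legendreP_orthogonal n) ha

theorem polyIntegral_nodePoly_mul {w q : ℝ[X]} (hq : q ≠ 0)
    (hcard : q.roots.toFinset.card = q.natDegree) {r : ℝ[X]}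
    (h : polyIntegral (w * q * r) = 0) : polyIntegral (w * nodePoly q.roots.toFinset * r) = 0 := by
  rw [eq_C_mul_nodePoly hcard, mul_left_comm, mul_assoc, polyIntegral_C_mul] at h
  exact (mul_eq_zero.1 h).resolve_left (leadingCoeff_ne_zero.2 hq)

theorem polyIntegral_eq_gauss (n : ℕ) (p : ℝ[X]) (hp : p.degree < (2 * n : ℕ)) :
    polyIntegral p = gauss n (fun x => p.eval x) := by
  have hdeg := natDegree_legendreP n
  have hcard := card_roots_legendreP n
  have hq := legendreP_ne_zero n
  refine polyIntegral_eq_sum _ n _ (fun r hr => ?_) (fun z hz => ?_) p (by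
    rwa [hcard, ← two_mul])
  · have := polyIntegral_nodePoly_mul hq (hcard.trans hdeg.symm)
      (legendreP_orthogonal n r (hdeg.symm ▸ hr))
    rwa [one_mul] at this
  · have hzr : (legendreP n).IsRoot z := isRoot_of_mem_roots (Multiset.mem_toFinset.1 hz)
    have hzI := mem_Ioo_of_isRoot_legendreP hzr
    obtain ⟨v, hv⟩ := dvd_iff_isRoot.2 hzr
    have hvd := natDegree_of_eq_X_sub_C_mul hq hv
    have hvz : v.eval z = (derivative (legendreP n)).eval z := by
      rw [hv, eval_derivative_X_sub_C_mul]
    have hvz0 : v.eval z ≠ 0 :=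
      hvz ▸ eval_derivative_ne_zero_of_card hq (hcard.trans hdeg.symm) hzr
    -- With `v = P_n / (X - z)`, the square vanishes at all other nodes and has integral `2 / (1 -
    -- z²)`.
    refine ⟨v ^ 2, ?_, ?_, fun b hb hbz => ?_, ?_⟩
    · refine degree_lt_of_natDegree_lt' (natDegree_pow_le.trans_lt ?_)
      omega
    · rw [eval_pow]; exact pow_ne_zero 2 hvz0
    · rw [eval_pow, eval_eq_zero_of_X_sub_C_mul hv
        (isRoot_of_mem_roots (Multiset.mem_toFinset.1 hb)) hbz, zero_pow two_ne_zero]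
    · rw [polyIntegral_sq_of_orthogonal hzI hv (polyIntegral_legendreP_mul n _
        (degree_derivative_lt_of_natDegree_le (by omega))), eval_one_legendreP,
        eval_neg_one_legendreP, eval_pow]
      -- At a root of `P_n` the recurrence reads `(z² - 1) v(z) = (n + 1) P_{n+1}(z)`, which turns
      -- the weight into one involving `v(z)` only.
      have h1 := congrArg (eval z) (X_sq_sub_one_mul_derivative_legendreP n)
      simp only [eval_mul, eval_sub, eval_pow, eval_X, eval_one, eval_C, hzr.eq_zero,
        ← hvz] at h1
      have hz1 : (1 : ℝ) - z ≠ 0 := by linarith [hzI.2]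
      have hz2 : (1 : ℝ) + z ≠ 0 := by linarith [hzI.1]
      have hz3 : z ^ 2 - 1 ≠ 0 := by
        rw [show z ^ 2 - 1 = -((1 - z) * (1 + z)) by ring]
        exact neg_ne_zero.2 (mul_ne_zero hz1 hz2)
      have h2 : ((n : ℝ) + 1) ^ 2 * (legendreP (n + 1)).eval z ^ 2 =
          ((z ^ 2 - 1) * v.eval z) ^ 2 := by rw [h1]; ring
      rw [h2, ← pow_mul, mul_comm n, pow_mul, neg_one_sq, one_pow]
      field_simp
      ring

end Gauss

/-! ### Exactness of Lobatto quadrature -/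

section Lobatto

theorem natDegree_derivative_legendreP (n : ℕ) :
    (derivative (legendreP n)).natDegree = n - 1 := by
  rw [natDegree_derivative, natDegree_legendreP]

theorem derivative_legendreP_ne_zero {n : ℕ} (hn : 1 ≤ n) : derivative (legendreP n) ≠ 0 := by
  intro h
  have h1 := eval_one_derivative_legendreP n
  rw [h, eval_zero] at h1
  have : (0 : ℝ) < n := by exact_mod_cast hn
  have : (0 : ℝ) < n * (n + 1) / 2 := by positivity
  linarith

/-- The recurrence writes `(1 - X²) P_n'` as a combination of `X P_n` and `P_{n+1}`, both orthogonal
to polynomials of degree less than `n - 1`. -/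
theorem derivative_legendreP_orthogonal (n : ℕ) (r : ℝ[X])
    (hr : r.degree < (derivative (legendreP n)).natDegree) :
    polyIntegral ((1 - X ^ 2) * derivative (legendreP n) * r) = 0 := by
  rw [natDegree_derivative_legendreP] at hr
  have h1 : (1 - X ^ 2) * derivative (legendreP n) * r =
      C (n + 1 : ℝ) * (legendreP n * (X * r)) - C (n + 1 : ℝ) * (legendreP (n + 1) * r) := by
    linear_combination -r * X_sq_sub_one_mul_derivative_legendreP n
  rw [h1, map_sub, polyIntegral_C_mul, polyIntegral_C_mul, polyIntegral_legendreP_mul (n + 1),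
    polyIntegral_legendreP_mul n]
  · ring
  · rcases Nat.eq_zero_or_pos n with rfl | hn
    · have : r = 0 := by simpa using hr
      simp [this]
    · exact degree_mul_lt natDegree_X_le hr (by omega)
  · exact hr.trans_le (by exact_mod_cast (by omega : n - 1 ≤ n + 1))

theorem one_sub_X_sq_ne_zero : (1 - X ^ 2 : ℝ[X]) ≠ 0 := fun h => by
  have := congrArg (eval 0) h
  simp at this

theorem one_sub_X_sq_nonneg : ∀ x ∈ Set.Icc (-1 : ℝ) 1, 0 ≤ (1 - X ^ 2 : ℝ[X]).eval x := by
  intro x hx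
  simp only [eval_sub, eval_one, eval_pow, eval_X]
  nlinarith [hx.1, hx.2]

theorem card_roots_derivative_legendreP {n : ℕ} (hn : 1 ≤ n) :
    (derivative (legendreP n)).roots.toFinset.card = n - 1 :=
  (card_roots_of_orthogonal (derivative_legendreP_ne_zero hn) one_sub_X_sq_ne_zero
    one_sub_X_sq_nonneg (derivative_legendreP_orthogonal n)).trans
    (natDegree_derivative_legendreP n)

theorem mem_Ioo_of_isRoot_derivative_legendreP {n : ℕ} (hn : 1 ≤ n) {a : ℝ}
    (ha : (derivative (legendreP n)).IsRoot a) : a ∈ Set.Ioo (-1 : ℝ) 1 :=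
  mem_Ioo_of_orthogonal (derivative_legendreP_ne_zero hn) one_sub_X_sq_ne_zero
    one_sub_X_sq_nonneg (derivative_legendreP_orthogonal n) ha

theorem polyIntegral_derivative_mul_legendreP {n : ℕ} (g : ℝ[X]) (hg : g.natDegree ≤ n) :
    polyIntegral (derivative (legendreP n) * g) = g.eval 1 - (-1) ^ n * g.eval (-1) := by
  have h1 := polyIntegral_derivative (legendreP n * g)
  rw [derivative_mul, map_add, polyIntegral_legendreP_mul n _
    (degree_derivative_lt_of_natDegree_le hg), add_zero] at h1
  rw [h1, eval_mul, eval_mul, eval_one_legendreP, eval_neg_one_legendreP, one_mul]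

/-- With `q = P_n'`, the derivative of `(1 - X²) q v` is `(1 - X²) v² + 2 (1 - X²) q v' - 2 q X v`.
The product vanishes at `±1`, the middle term integrates to zero by orthogonality, and the last
reduces to boundary values because `X v` has degree at most `n`. -/
theorem polyIntegral_one_sub_X_sq_mul_sq {n : ℕ} {v : ℝ[X]} {z : ℝ}
    (hn : 1 ≤ n) (hz : z ∈ Set.Ioo (-1 : ℝ) 1) (hv : derivative (legendreP n) = (X - C z) * v) :
    polyIntegral ((1 - X ^ 2) * v ^ 2) = 2 * n * (n + 1) / (1 - z ^ 2) := by
  have hvd := natDegree_of_eq_X_sub_C_mul (derivative_legendreP_ne_zero hn) hv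
  rw [natDegree_derivative_legendreP] at hvd
  set q := derivative (legendreP n) with hq
  have h1 := polyIntegral_derivative ((1 - X ^ 2) * (q * v))
  have h2 : derivative ((1 - X ^ 2) * (q * v)) = (1 - X ^ 2) * v ^ 2
      + C 2 * ((1 - X ^ 2) * q * derivative v) - C 2 * (q * (X * v)) := by
    rw [hv, map_ofNat]
    simp only [derivative_mul, derivative_sub, derivative_X, derivative_C, derivative_one,
      derivative_X_pow]
    simp [map_ofNat]
    ring
  rw [h2, map_sub, map_add, polyIntegral_C_mul, polyIntegral_C_mul,
    derivative_legendreP_orthogonal n _ (by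
      rw [natDegree_derivative_legendreP]
      exact degree_derivative_lt_of_natDegree_le (by omega)),
    polyIntegral_derivative_mul_legendreP _ (natDegree_mul_le.trans (by
      rw [natDegree_X]; omega))] at h1
  have e1 := eval_one_derivative_legendreP n
  have e2 := eval_neg_one_derivative_legendreP n
  rw [← hq, hv] at e1 e2
  simp only [eval_mul, eval_sub, eval_X, eval_C, eval_one, eval_pow] at h1 e1 e2
  have hz1 : (1 : ℝ) - z ≠ 0 := by linarith [hz.2]
  have hz2 : (1 : ℝ) + z ≠ 0 := by linarith [hz.1]
  have hz3 : 1 - z ^ 2 ≠ 0 := by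
    rw [show 1 - z ^ 2 = (1 - z) * (1 + z) by ring]
    exact mul_ne_zero hz1 hz2
  have hs : ((-1 : ℝ) ^ n) * (-1) ^ n = 1 := by
    rw [← mul_pow]; norm_num
  rw [eq_div_iff hz3]
  linear_combination (1 - z ^ 2) * h1 + 2 * (1 + z) * e1 - 2 * (-1) ^ n * (1 - z) * e2 +
    (1 - z) * (n * (n + 1)) * hs

theorem nodePoly_insert {a : ℝ} {s : Finset ℝ} (h : a ∉ s) :
    nodePoly (insert a s) = (X - C a) * nodePoly s :=
  Lagrange.nodal_insert_eq_nodal h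

/-- Legendre's equation at a critical point of `P_n`. It converts the value of `P_n` in the weight
into that of `P_n''`, which is the value of `P_n' / (X - z)` at `z`. -/
theorem eval_derivative_derivative_legendreP {n : ℕ} {z : ℝ}
    (hz : (derivative (legendreP n)).IsRoot z) :
    (1 - z ^ 2) * (derivative (derivative (legendreP n))).eval z =
      -(n * (n + 1) * (legendreP n).eval z) := by
  have h := congrArg (eval z) (derivative_X_sq_sub_one_mul_derivative_legendreP n)
  rw [derivative_mul] at h
  simp only [eval_mul, eval_add, hz.eq_zero, eval_C, eval_sub, eval_pow, eval_X, eval_one] at h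
  linarith

/-- The weights of the Lobatto quadrature with `n + 1` nodes. -/
noncomputable def lobattoWeight (n : ℕ) (x : ℝ) : ℝ :=
  2 / (n * (n + 1) * (legendreP n).eval x ^ 2)

/-- Because `P_n(±1)² = 1`, the formula for the interior weights also covers the end points. -/
theorem lobatto_succ_eq_sum {n : ℕ} (hn : 1 ≤ n) (f : ℝ → ℝ) :
    lobatto (n + 1) f = ∑ x ∈ insert (-1) (insert 1 (derivative (legendreP n)).roots.toFinset),
      lobattoWeight n x * f x := by
  have hI : ∀ a ∈ (derivative (legendreP n)).roots.toFinset, a ∈ Set.Ioo (-1 : ℝ) 1 :=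
    fun a ha => mem_Ioo_of_isRoot_derivative_legendreP hn
      (isRoot_of_mem_roots (Multiset.mem_toFinset.1 ha))
  rw [Finset.sum_insert, Finset.sum_insert, lobatto]
  · simp only [lobattoWeight, eval_one_legendreP, eval_neg_one_legendreP, ← pow_mul, mul_comm n 2]
    simp only [pow_mul, neg_one_sq, one_pow, mul_one]
    push_cast
    rw [add_sub_cancel_right, mul_comm ((n : ℝ) + 1), add_assoc]
  · exact fun h => lt_irrefl _ (hI 1 h).2
  · intro h
    rcases Finset.mem_insert.1 h with h | h
    · norm_num at h
    · exact lt_irrefl _ (hI _ h).1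

theorem polyIntegral_eq_lobatto (n : ℕ) (hn : 1 ≤ n) (p : ℝ[X]) (hp : p.degree < (2 * n : ℕ)) :
    polyIntegral p = lobatto (n + 1) (fun x => p.eval x) := by
  have hdeg := natDegree_derivative_legendreP n
  have hcard := card_roots_derivative_legendreP hn
  have hq := derivative_legendreP_ne_zero hn
  have hroot : ∀ a ∈ (derivative (legendreP n)).roots.toFinset,
      (derivative (legendreP n)).IsRoot a :=
    fun a ha => isRoot_of_mem_roots (Multiset.mem_toFinset.1 ha)
  have hI : ∀ a ∈ (derivative (legendreP n)).roots.toFinset, a ∈ Set.Ioo (-1 : ℝ) 1 :=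
    fun a ha => mem_Ioo_of_isRoot_derivative_legendreP hn (hroot a ha)
  have h1 : (1 : ℝ) ∉ (derivative (legendreP n)).roots.toFinset :=
    fun h => lt_irrefl _ (hI 1 h).2
  have h2 : (-1 : ℝ) ∉ insert 1 (derivative (legendreP n)).roots.toFinset := by
    intro h
    rcases Finset.mem_insert.1 h with h | h
    · norm_num at h
    · exact lt_irrefl _ (hI _ h).1
  have hTcard : (insert (-1) (insert 1 (derivative (legendreP n)).roots.toFinset)).card =
      n + 1 := by
    rw [Finset.card_insert_of_notMem h2, Finset.card_insert_of_notMem h1, hcard]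
    omega
  have hn0 : (0 : ℝ) < n := by exact_mod_cast hn
  have hs : ((-1 : ℝ) ^ n) * (-1) ^ n = 1 := by
    rw [← mul_pow]; norm_num
  have hs0 : ((-1 : ℝ) ^ n) ≠ 0 := left_ne_zero_of_mul (by rw [hs]; exact one_ne_zero)
  have e1 := eval_one_derivative_legendreP n
  have e2 := eval_neg_one_derivative_legendreP n
  rw [lobatto_succ_eq_sum hn]
  refine polyIntegral_eq_sum _ (n - 1) _ (fun r hr => ?_) (fun z hz => ?_) p (by
    rwa [hTcard, show n + 1 + (n - 1) = 2 * n by omega])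
  · have := polyIntegral_nodePoly_mul hq (hcard.trans hdeg.symm)
      (derivative_legendreP_orthogonal n r (hdeg.symm ▸ hr))
    rw [nodePoly_insert h2, nodePoly_insert h1]
    rw [show (X - C (-1 : ℝ)) * ((X - C 1) * nodePoly (derivative (legendreP n)).roots.toFinset) * r
      = -((1 - X ^ 2) * nodePoly (derivative (legendreP n)).roots.toFinset * r) by
        simp only [map_neg, map_one]; ring, map_neg, this, neg_zero]
  rcases Finset.mem_insert.1 hz with rfl | hz
  · refine ⟨derivative (legendreP n) * (1 - X), ?_, ?_, fun b hb hbz => ?_, ?_⟩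
    · refine degree_lt_of_natDegree_lt' (natDegree_mul_le.trans_lt ?_)
      have : (1 - X : ℝ[X]).natDegree ≤ 1 := by compute_degree
      omega
    · rw [eval_mul, e2]
      simp only [eval_sub, eval_one, eval_X]
      have : (n : ℝ) * (n + 1) / 2 ≠ 0 := by positivity
      exact mul_ne_zero (mul_ne_zero (neg_ne_zero.2 hs0) this) (by norm_num)
    · rcases Finset.mem_insert.1 hb with rfl | hb
      · exact absurd rfl hbz
      · rcases Finset.mem_insert.1 hb with rfl | hb
        · simp
        · rw [eval_mul, (hroot b hb).eq_zero, zero_mul]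
    · rw [polyIntegral_derivative_mul_legendreP _ ((by compute_degree :
        (1 - X : ℝ[X]).natDegree ≤ 1).trans hn), eval_mul, e2, lobattoWeight,
        eval_neg_one_legendreP]
      simp only [eval_sub, eval_one, eval_X]
      rw [sq ((-1 : ℝ) ^ n), hs]
      field_simp
      ring
  rcases Finset.mem_insert.1 hz with rfl | hz
  · refine ⟨derivative (legendreP n) * (1 + X), ?_, ?_, fun b hb hbz => ?_, ?_⟩
    · refine degree_lt_of_natDegree_lt' (natDegree_mul_le.trans_lt ?_)
      have : (1 + X : ℝ[X]).natDegree ≤ 1 := by compute_degree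
      omega
    · rw [eval_mul, e1]
      simp only [eval_add, eval_one, eval_X]
      positivity
    · rcases Finset.mem_insert.1 hb with rfl | hb
      · simp
      · rcases Finset.mem_insert.1 hb with rfl | hb
        · exact absurd rfl hbz
        · rw [eval_mul, (hroot b hb).eq_zero, zero_mul]
    · rw [polyIntegral_derivative_mul_legendreP _ ((by compute_degree :
        (1 + X : ℝ[X]).natDegree ≤ 1).trans hn), eval_mul, e1, lobattoWeight,
        eval_one_legendreP]
      simp only [eval_add, eval_one, eval_X]
      field_simp
      ring
  · have hzr := hroot z hz
    have hzI := hI z hz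
    obtain ⟨v, hv⟩ := dvd_iff_isRoot.2 hzr
    have hvd := natDegree_of_eq_X_sub_C_mul hq hv
    have hvz : v.eval z = (derivative (derivative (legendreP n))).eval z := by
      rw [hv, eval_derivative_X_sub_C_mul]
    have hvz0 : v.eval z ≠ 0 :=
      hvz ▸ eval_derivative_ne_zero_of_card hq (hcard.trans hdeg.symm) hzr
    have hz0 : 0 < 1 - z ^ 2 := by nlinarith [hzI.1, hzI.2]
    refine ⟨(1 - X ^ 2) * v ^ 2, ?_, ?_, fun b hb hbz => ?_, ?_⟩
    · refine degree_lt_of_natDegree_lt' (natDegree_mul_le.trans_lt ?_)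
      have h3 : (1 - X ^ 2 : ℝ[X]).natDegree ≤ 2 := by compute_degree
      have h4 : (v ^ 2).natDegree ≤ 2 * v.natDegree := natDegree_pow_le
      omega
    · simp only [eval_mul, eval_sub, eval_one, eval_pow, eval_X]
      positivity
    · rcases Finset.mem_insert.1 hb with rfl | hb
      · simp
      rcases Finset.mem_insert.1 hb with rfl | hb
      · simp
      · rw [eval_mul, eval_pow, eval_eq_zero_of_X_sub_C_mul hv (hroot b hb) hbz,
          zero_pow two_ne_zero, mul_zero]
    · rw [polyIntegral_one_sub_X_sq_mul_sq hn hzI hv]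
      have h5 := eval_derivative_derivative_legendreP hzr
      rw [← hvz] at h5
      simp only [eval_mul, eval_sub, eval_one, eval_pow, eval_X, lobattoWeight]
      have h6 : (legendreP n).eval z ^ 2 =
          ((1 - z ^ 2) * v.eval z) ^ 2 / (n * (n + 1)) ^ 2 := by
        rw [h5]; field_simp
      rw [h6]
      field_simp

end Lobatto

/-! ### Exactness of left Radau quadrature -/

section Radau

theorem X_add_one_mul_radauPoly (n : ℕ) :
    (X + 1) * radauPoly (n + 1) = legendreP n + legendreP (n + 1) := by
  have h : (X + 1 : ℝ[X]) = X - C (-1) := by simp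
  rw [radauPoly, add_tsub_cancel_right, h, mul_div_eq_iff_isRoot, IsRoot, eval_add,
    eval_neg_one_legendreP, eval_neg_one_legendreP, pow_succ]
  ring

theorem natDegree_legendreP_add_succ (n : ℕ) :
    (legendreP n + legendreP (n + 1)).natDegree = n + 1 := by
  rw [natDegree_add_eq_right_of_natDegree_lt] <;> simp [natDegree_legendreP]

theorem radauPoly_ne_zero (n : ℕ) : radauPoly (n + 1) ≠ 0 := fun h => by
  have h1 := X_add_one_mul_radauPoly n
  have h2 := natDegree_legendreP_add_succ n
  rw [← h1, h, mul_zero, natDegree_zero] at h2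
  omega

theorem natDegree_radauPoly (n : ℕ) : (radauPoly (n + 1)).natDegree = n := by
  have h1 := natDegree_legendreP_add_succ n
  have h2 : (X + 1 : ℝ[X]).natDegree = 1 := by compute_degree!
  have h3 : (X + 1 : ℝ[X]) ≠ 0 := fun h => by simp [h] at h2
  rw [← X_add_one_mul_radauPoly, natDegree_mul h3 (radauPoly_ne_zero n), h2] at h1
  omega

theorem polyIntegral_legendreP_add_succ_mul (n : ℕ) (r : ℝ[X]) (hr : r.degree < n) :
    polyIntegral ((legendreP n + legendreP (n + 1)) * r) = 0 := by
  rw [add_mul, map_add, polyIntegral_legendreP_mul n r hr, polyIntegral_legendreP_mul (n + 1) r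
    (hr.trans (by exact_mod_cast n.lt_succ_self)), add_zero]

theorem radauPoly_orthogonal (n : ℕ) (r : ℝ[X]) (hr : r.degree < (radauPoly (n + 1)).natDegree) :
    polyIntegral ((X + 1) * radauPoly (n + 1) * r) = 0 := by
  rw [X_add_one_mul_radauPoly]
  exact polyIntegral_legendreP_add_succ_mul n r (natDegree_radauPoly n ▸ hr)

theorem X_add_one_ne_zero : (X + 1 : ℝ[X]) ≠ 0 := fun h => by
  have := congrArg (eval 0) h
  simp at this

theorem X_add_one_nonneg : ∀ x ∈ Set.Icc (-1 : ℝ) 1, 0 ≤ (X + 1 : ℝ[X]).eval x := by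
  intro x hx
  simp only [eval_add, eval_one, eval_X]
  linarith [hx.1]

theorem card_roots_radauPoly (n : ℕ) : (radauPoly (n + 1)).roots.toFinset.card = n :=
  (card_roots_of_orthogonal (radauPoly_ne_zero n) X_add_one_ne_zero X_add_one_nonneg
    (radauPoly_orthogonal n)).trans (natDegree_radauPoly n)

theorem mem_Ioo_of_isRoot_radauPoly {n : ℕ} {a : ℝ} (ha : (radauPoly (n + 1)).IsRoot a) :
    a ∈ Set.Ioo (-1 : ℝ) 1 :=
  mem_Ioo_of_orthogonal (radauPoly_ne_zero n) X_add_one_ne_zero X_add_one_nonneg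
    (radauPoly_orthogonal n) ha

theorem eval_one_radauPoly (n : ℕ) : (radauPoly (n + 1)).eval 1 = 1 := by
  have h := congrArg (eval 1) (X_add_one_mul_radauPoly n)
  simp only [eval_mul, eval_add, eval_X, eval_one, eval_one_legendreP] at h
  linarith

theorem eval_neg_one_radauPoly (n : ℕ) :
    (radauPoly (n + 1)).eval (-1) = (-1) ^ n * (n + 1) := by
  have h := congrArg (fun p => eval (-1) (derivative p)) (X_add_one_mul_radauPoly n)
  simp only [derivative_mul, derivative_add, eval_mul, eval_add, eval_X, eval_one, derivative_X,
    derivative_one, eval_neg_one_derivative_legendreP, eval_zero, pow_succ] at h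
  push_cast at h
  linarith

/-- The derivative of `(X + 1) q²` is `q² + 2 (X + 1) q q'`, whose second term integrates to zero by
weighted orthogonality. The square `q²` serves as the test polynomial at the node `-1`. -/
theorem polyIntegral_radauPoly_sq (n : ℕ) : polyIntegral (radauPoly (n + 1) ^ 2) = 2 := by
  set q := radauPoly (n + 1) with hq
  have h1 := polyIntegral_derivative ((X + 1) * q ^ 2)
  have h2 : derivative ((X + 1) * q ^ 2) = q ^ 2 + C 2 * ((X + 1) * q * derivative q) := by
    rw [map_ofNat]
    simp only [derivative_mul, derivative_add, derivative_X, derivative_one, sq]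
    ring
  rw [h2, map_add, polyIntegral_C_mul, radauPoly_orthogonal n _
    (degree_derivative_lt_of_natDegree_le le_rfl)] at h1
  simp only [eval_mul, eval_add, eval_X, eval_one, eval_pow, hq, eval_one_radauPoly] at h1
  rw [← hq] at h1
  linarith

/-- When `P_{n+1}(z) = -P_n(z)`, the two recurrences give both derivatives, multiplied by `z² - 1`,
the value `-(n + 1)(1 + z) P_n(z)`. -/
theorem eval_derivative_legendreP_succ_eq {n : ℕ} {z : ℝ} (hz : z ∈ Set.Ioo (-1 : ℝ) 1)
    (h : (legendreP n + legendreP (n + 1)).IsRoot z) :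
    (derivative (legendreP (n + 1))).eval z = (derivative (legendreP n)).eval z := by
  have h1 := congrArg (eval z) (X_sq_sub_one_mul_derivative_legendreP n)
  have h2 := congrArg (eval z) (X_sq_sub_one_mul_derivative_legendreP_succ n)
  rw [IsRoot, eval_add] at h
  simp only [eval_mul, eval_sub, eval_pow, eval_X, eval_one, eval_C] at h1 h2
  have hz0 : z ^ 2 - 1 ≠ 0 := by nlinarith [hz.1, hz.2]
  apply mul_left_cancel₀ hz0
  linear_combination h2 - h1 + (n + 1) * (z - 1) * h

/-- The weights of the left Radau quadrature with `n + 1` nodes. -/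
noncomputable def radauWeight (n : ℕ) (x : ℝ) : ℝ :=
  if x = -1 then 2 / ((n : ℝ) + 1) ^ 2
  else 1 / ((1 - x) * (derivative (legendreP n)).eval x ^ 2)

theorem radauLeft_succ_eq_sum (n : ℕ) (f : ℝ → ℝ) :
    radauLeft (n + 1) f = ∑ x ∈ insert (-1) (radauPoly (n + 1)).roots.toFinset,
      radauWeight n x * f x := by
  have hI : ∀ a ∈ (radauPoly (n + 1)).roots.toFinset, a ∈ Set.Ioo (-1 : ℝ) 1 :=
    fun a ha => mem_Ioo_of_isRoot_radauPoly (isRoot_of_mem_roots (Multiset.mem_toFinset.1 ha))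
  rw [Finset.sum_insert fun h => lt_irrefl _ (hI _ h).1, radauLeft, radauWeight, if_pos rfl]
  push_cast
  congr 1
  refine Finset.sum_congr rfl fun x hx => ?_
  rw [radauWeight, if_neg (hI x hx).1.ne']

theorem polyIntegral_eq_radauLeft (n : ℕ) (p : ℝ[X]) (hp : p.degree < (2 * n + 1 : ℕ)) :
    polyIntegral p = radauLeft (n + 1) (fun x => p.eval x) := by
  have hdeg := natDegree_radauPoly n
  have hcard := card_roots_radauPoly n
  have hq := radauPoly_ne_zero n
  have hroot : ∀ a ∈ (radauPoly (n + 1)).roots.toFinset, (radauPoly (n + 1)).IsRoot a :=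
    fun a ha => isRoot_of_mem_roots (Multiset.mem_toFinset.1 ha)
  have hI : ∀ a ∈ (radauPoly (n + 1)).roots.toFinset, a ∈ Set.Ioo (-1 : ℝ) 1 :=
    fun a ha => mem_Ioo_of_isRoot_radauPoly (hroot a ha)
  have h1 : (-1 : ℝ) ∉ (radauPoly (n + 1)).roots.toFinset := fun h => lt_irrefl _ (hI _ h).1
  have hTcard : (insert (-1) (radauPoly (n + 1)).roots.toFinset).card = n + 1 := by
    rw [Finset.card_insert_of_notMem h1, hcard]
  rw [radauLeft_succ_eq_sum]
  refine polyIntegral_eq_sum _ n _ (fun r hr => ?_) (fun z hz => ?_) p (by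
    rwa [hTcard, show n + 1 + n = 2 * n + 1 by omega])
  · have := polyIntegral_nodePoly_mul hq (hcard.trans hdeg.symm)
      (radauPoly_orthogonal n r (hdeg.symm ▸ hr))
    rwa [nodePoly_insert h1, map_neg, sub_neg_eq_add, map_one]
  rcases Finset.mem_insert.1 hz with rfl | hz
  · have hs : ((-1 : ℝ) ^ n) ^ 2 = 1 := by rw [← pow_mul, mul_comm, pow_mul]; norm_num
    have hs0 : ((-1 : ℝ) ^ n) ≠ 0 := by positivity
    refine ⟨radauPoly (n + 1) ^ 2, ?_, ?_, fun b hb hbz => ?_, ?_⟩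
    · refine degree_lt_of_natDegree_lt' (natDegree_pow_le.trans_lt ?_)
      omega
    · rw [eval_pow, eval_neg_one_radauPoly]
      positivity
    · rw [eval_pow, (hroot b ((Finset.mem_insert.1 hb).resolve_left hbz)).eq_zero,
        zero_pow two_ne_zero]
    · rw [polyIntegral_radauPoly_sq, radauWeight, if_pos rfl, eval_pow, eval_neg_one_radauPoly,
        mul_pow, hs]
      field_simp
  · have hzr := hroot z hz
    have hzI := hI z hz
    obtain ⟨t, ht⟩ := dvd_iff_isRoot.2 hzr
    have htd := natDegree_of_eq_X_sub_C_mul hq ht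
    -- Dividing `P_n + P_{n+1}`, rather than the Radau polynomial, by `X - z` keeps the factor `X +
    -- 1`. The square then vanishes at the node `-1` too, and unweighted orthogonality applies.
    have hS : legendreP n + legendreP (n + 1) = (X - C z) * ((X + 1) * t) := by
      rw [← X_add_one_mul_radauPoly, ht]; ring
    have hSz : (legendreP n + legendreP (n + 1)).IsRoot z := dvd_iff_isRoot.1 ⟨_, hS⟩
    have hvz : ((X + 1) * t).eval z = 2 * (derivative (legendreP n)).eval z := by
      rw [← eval_derivative_X_sub_C_mul, ← hS, derivative_add, eval_add,
        eval_derivative_legendreP_succ_eq hzI hSz, two_mul]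
    have htz : t.eval z ≠ 0 := by
      rw [← eval_derivative_X_sub_C_mul, ← ht]
      exact eval_derivative_ne_zero_of_card hq (hcard.trans hdeg.symm) hzr
    have hz1 : (0 : ℝ) < 1 - z := by linarith [hzI.2]
    have hz2 : (0 : ℝ) < 1 + z := by linarith [hzI.1]
    have hvz0 : ((X + 1) * t).eval z ≠ 0 := by
      simp only [eval_mul, eval_add, eval_X, eval_one]
      exact mul_ne_zero (by linarith) htz
    have hvd : ((X + 1) * t).natDegree ≤ n := by
      refine natDegree_mul_le.trans ?_
      have : (X + 1 : ℝ[X]).natDegree = 1 := by compute_degree!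
      omega
    refine ⟨((X + 1) * t) ^ 2, ?_, ?_, fun b hb hbz => ?_, ?_⟩
    · refine degree_lt_of_natDegree_lt' (natDegree_pow_le.trans_lt ?_)
      omega
    · rw [eval_pow]; exact pow_ne_zero 2 hvz0
    · rcases Finset.mem_insert.1 hb with rfl | hb
      · simp
      · rw [eval_pow, eval_mul, eval_eq_zero_of_X_sub_C_mul ht (hroot b hb) hbz, mul_zero,
          zero_pow two_ne_zero]
    · rw [polyIntegral_sq_of_orthogonal hzI hS (polyIntegral_legendreP_add_succ_mul n _
        (degree_derivative_lt_of_natDegree_le hvd)), eval_pow, radauWeight, if_neg hzI.1.ne']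
      rw [hvz] at hvz0 ⊢
      have hd : (derivative (legendreP n)).eval z ≠ 0 := right_ne_zero_of_mul hvz0
      simp only [eval_add, eval_one_legendreP, eval_neg_one_legendreP, pow_succ]
      field_simp
      ring

end Radau

/-! ### Divided differences in symmetric form -/

/-- The divided difference of `f` on a finite set of points, in symmetric form. -/
noncomputable def finsetDividedDiff (f : ℝ → ℝ) (S : Finset ℝ) : ℝ :=
  ∑ x ∈ S, f x / ∏ y ∈ S.erase x, (x - y)

theorem finsetDividedDiff_insert (f : ℝ → ℝ) {S : Finset ℝ} {a : ℝ} (ha : a ∉ S) :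
    finsetDividedDiff f (insert a S) =
      f a / ∏ y ∈ S, (a - y) + ∑ x ∈ S, f x / ((x - a) * ∏ y ∈ S.erase x, (x - y)) := by
  rw [finsetDividedDiff, Finset.sum_insert ha, Finset.erase_insert ha]
  congr 1
  refine Finset.sum_congr rfl fun x hx => ?_
  have hxa : x ≠ a := fun h => ha (h ▸ hx)
  rw [Finset.erase_insert_of_ne hxa.symm, Finset.prod_insert fun h => ha (Finset.mem_of_mem_erase h)]

theorem prod_sub_ne_zero {S : Finset ℝ} {a : ℝ} (ha : a ∉ S) : ∏ y ∈ S, (a - y) ≠ 0 :=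
  Finset.prod_ne_zero_iff.2 fun _ hy => sub_ne_zero.2 fun h => ha (h ▸ hy)

/-- Term by term this is the partial fraction identity `(b - a) / ((x - a)(x - b)) = 1 / (x - b) - 1
/ (x - a)`. It expresses the effect of exchanging a single node. -/
theorem finsetDividedDiff_insert_sub (f : ℝ → ℝ) {S : Finset ℝ} {a b : ℝ} (ha : a ∉ S)
    (hb : b ∉ S) (hab : a ≠ b) :
    finsetDividedDiff f (insert b S) - finsetDividedDiff f (insert a S) =
      (b - a) * finsetDividedDiff f (insert a (insert b S)) := by
  have hb' : b - a ≠ 0 := sub_ne_zero.2 hab.symm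
  have ha' : a - b ≠ 0 := sub_ne_zero.2 hab
  have haS : a ∉ insert b S := by simp [hab, ha]
  rw [finsetDividedDiff_insert f haS, Finset.prod_insert hb, Finset.sum_insert hb,
    Finset.erase_insert hb, finsetDividedDiff_insert f ha, finsetDividedDiff_insert f hb]
  have h1 : ∀ x ∈ S, f x / ((x - a) * ∏ y ∈ (insert b S).erase x, (x - y)) * (b - a) =
      f x / ((x - b) * ∏ y ∈ S.erase x, (x - y)) - f x / ((x - a) * ∏ y ∈ S.erase x, (x - y)) := by
    intro x hx
    have hxa : x - a ≠ 0 := sub_ne_zero.2 fun h => ha (h ▸ hx)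
    have hxb : x ≠ b := fun h => hb (h ▸ hx)
    have hxb' : x - b ≠ 0 := sub_ne_zero.2 hxb
    rw [Finset.erase_insert_of_ne hxb.symm,
      Finset.prod_insert fun h => hb (Finset.mem_of_mem_erase h)]
    have := prod_sub_ne_zero (Finset.notMem_erase x S)
    field_simp
    ring
  have h2 := Finset.sum_congr rfl h1
  rw [← Finset.sum_mul, Finset.sum_sub_distrib] at h2
  have hpa := prod_sub_ne_zero ha
  have hpb := prod_sub_ne_zero hb
  have h3 : (b - a) * (f a / ((a - b) * ∏ y ∈ S, (a - y))) = -(f a / ∏ y ∈ S, (a - y)) := by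
    field_simp
    ring
  have h4 : (b - a) * (f b / ((b - a) * ∏ y ∈ S, (b - y))) = f b / ∏ y ∈ S, (b - y) := by
    field_simp
  linear_combination -h2 - h3 - h4

theorem dividedDiff_eq_finsetDividedDiff (f : ℝ → ℝ) (k : ℕ) (x : Fin (k + 1) → ℝ)
    (hx : Function.Injective x) :
    dividedDiff f k x = finsetDividedDiff f (Finset.univ.image x) := by
  induction k with
  | zero =>
    have : Finset.univ.image x = insert (x 0) ∅ := by
      ext; simp
    rw [this, finsetDividedDiff_insert f (Finset.notMem_empty _)]
    simp [dividedDiff]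
  | succ k ih =>
    -- The recursion omits one end of the list at a time; `S` is the set of inner nodes common to
    -- both shorter lists.
    set S : Finset ℝ := Finset.univ.image fun i : Fin k => x i.succ.castSucc with hS
    have h1 : (Finset.univ.image fun i : Fin (k + 1) => x i.succ) =
        insert (x (Fin.last (k + 1))) S := by
      ext y
      simp only [hS, Finset.mem_image, Finset.mem_univ, true_and, Finset.mem_insert,
        Fin.exists_fin_succ', Fin.succ_last, Fin.succ_castSucc]
      rw [or_comm, eq_comm (a := y)]
    have h2 : (Finset.univ.image fun i : Fin (k + 1) => x i.castSucc) = insert (x 0) S := by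
      ext y
      simp only [hS, Finset.mem_image, Finset.mem_univ, true_and, Finset.mem_insert,
        Fin.exists_fin_succ, Fin.castSucc_zero]
      rw [eq_comm (a := y)]
    have h3 : Finset.univ.image x = insert (x 0) (insert (x (Fin.last (k + 1))) S) := by
      rw [← h1]
      ext y
      simp only [Finset.mem_image, Finset.mem_univ, true_and, Finset.mem_insert,
        Fin.exists_fin_succ]
      rw [eq_comm (a := y)]
    have h0 : x 0 ∉ S := by
      simp only [hS, Finset.mem_image, Finset.mem_univ, true_and, not_exists]
      intro i h
      have := congrArg Fin.val (hx h)
      simp at this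
    have hl : x (Fin.last (k + 1)) ∉ S := by
      simp only [hS, Finset.mem_image, Finset.mem_univ, true_and, not_exists]
      intro i h
      have := congrArg Fin.val (hx h)
      simp at this
      omega
    have h0l : x 0 ≠ x (Fin.last (k + 1)) := fun h => by
      have := congrArg Fin.val (hx h)
      simp at this
    rw [dividedDiff, ih (fun i => x i.succ) (hx.comp (Fin.succ_injective _)),
      ih (fun i => x i.castSucc) (hx.comp (Fin.castSucc_injective _)), h1, h2, h3,
      finsetDividedDiff_insert_sub f h0 hl h0l,
      mul_div_cancel_left₀ _ (sub_ne_zero.2 h0l.symm)]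

theorem IsNConvexOn.finsetDividedDiff_nonneg {m : ℕ} {s : Set ℝ} {f : ℝ → ℝ}
    (hf : IsNConvexOn m s f) {S : Finset ℝ} (hcard : S.card = m + 2) (hS : ∀ x ∈ S, x ∈ s) :
    0 ≤ finsetDividedDiff f S := by
  have h := hf (S.orderEmbOfFin hcard) (S.orderEmbOfFin hcard).injective
    fun i => hS _ (S.orderEmbOfFin_mem hcard i)
  rwa [dividedDiff_eq_finsetDividedDiff f (m + 1) _ (S.orderEmbOfFin hcard).injective,
    Finset.image_orderEmbOfFin_univ] at h

/-- Convexity of order `m` makes divided differences on `m + 1` points nondecreasing in each point;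
boundedness and integrability both rest on this. -/
theorem IsNConvexOn.finsetDividedDiff_insert_le {m : ℕ} {s : Set ℝ} {f : ℝ → ℝ}
    (hf : IsNConvexOn m s f) {S : Finset ℝ} {a b : ℝ} (hcard : S.card = m)
    (hS : ∀ x ∈ S, x ∈ s) (ha : a ∈ s) (hb : b ∈ s) (haS : a ∉ S) (hbS : b ∉ S) (hab : a < b) :
    finsetDividedDiff f (insert a S) ≤ finsetDividedDiff f (insert b S) := by
  rw [← sub_nonneg, finsetDividedDiff_insert_sub f haS hbS hab.ne]
  refine mul_nonneg (sub_nonneg.2 hab.le) (hf.finsetDividedDiff_nonneg ?_ ?_)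
  · rw [Finset.card_insert_of_notMem (by simp [hab.ne, haS]), Finset.card_insert_of_notMem hbS,
      hcard]
  · simp only [Finset.mem_insert]
    rintro x (rfl | rfl | hx)
    exacts [ha, hb, hS x hx]

/-- The error of Lagrange interpolation as a divided difference. -/
theorem sub_eval_interpolate (f : ℝ → ℝ) {S : Finset ℝ} {x : ℝ} (hx : x ∉ S) :
    f x - (Lagrange.interpolate S id f).eval x =
      finsetDividedDiff f (insert x S) * ∏ y ∈ S, (x - y) := by
  have hp := prod_sub_ne_zero hx
  rw [Lagrange.eval_interpolate_not_at_node f (fun i hi h => hx (by rw [h]; exact hi)),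
    Lagrange.eval_nodal, finsetDividedDiff_insert f hx, add_mul, div_mul_cancel₀ _ hp,
    sub_eq_add_neg, mul_comm (∏ y ∈ S, (x - id y)), ← neg_mul, ← Finset.sum_neg_distrib]
  congr 2
  refine Finset.sum_congr rfl fun i hi => ?_
  have h1 : x - i ≠ 0 := sub_ne_zero.2 fun h => hx (h ▸ hi)
  have h2 : i - x ≠ 0 := sub_ne_zero.2 fun h => hx (h ▸ hi)
  simp only [Lagrange.nodalWeight, id, Finset.prod_inv_distrib]
  have := prod_sub_ne_zero (Finset.notMem_erase i S)
  field_simp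
  ring

/-! ### Uniform bounds and integrability -/

/-- If replacing a point by a related one increases `G`, then `G S` is at most the value of `G` at
some subset of `Z`, provided that the points of `S` outside `Z` are related to all of `Y ⊆ Z`. -/
theorem exists_le_of_replace {G : Finset ℝ → ℝ} {D : Set ℝ} {r : ℝ → ℝ → Prop} {k : ℕ}
    (hG : ∀ (S : Finset ℝ) (a b : ℝ), S.card = k → (∀ x ∈ S, x ∈ D) → a ∈ D → b ∈ D →
      a ∉ S → b ∉ S → r a b → G (insert a S) ≤ G (insert b S))
    {Y Z : Finset ℝ} (hYZ : Y ⊆ Z) (hY : Y.card = k + 1) (hYD : ∀ y ∈ Y, y ∈ D)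
    (S : Finset ℝ) (hS : S.card = k + 1) (hSD : ∀ x ∈ S, x ∈ D)
    (hSY : ∀ x ∈ S, x ∈ Z ∨ ∀ y ∈ Y, r x y) :
    ∃ S' ⊆ Z, S'.card = k + 1 ∧ G S ≤ G S' := by
  induction hN : (S \ Z).card generalizing S with
  | zero =>
    exact ⟨S, Finset.sdiff_eq_empty_iff_subset.1 (Finset.card_eq_zero.1 hN), hS, le_rfl⟩
  | succ N ih =>
    obtain ⟨s, hs⟩ : (S \ Z).Nonempty := Finset.card_pos.1 (by omega)
    obtain ⟨hsS, hsZ⟩ := Finset.mem_sdiff.1 hs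
    have hc : (S.erase s).card = k := by rw [Finset.card_erase_of_mem hsS, hS]; rfl
    -- `Y` has one more element than `S.erase s`, so some target is free; moving `s` there leaves
    -- one point fewer outside `Z`.
    obtain ⟨y, hyY, hyS⟩ : ∃ y ∈ Y, y ∉ S.erase s :=
      Finset.exists_mem_notMem_of_card_lt_card (by omega)
    have hsub : ∀ x ∈ S.erase s, x ∈ D := fun x hx => hSD x (Finset.mem_of_mem_erase hx)
    have h1 := hG (S.erase s) s y hc hsub (hSD s hsS) (hYD y hyY) (Finset.notMem_erase s S) hyS
      ((hSY s hsS).resolve_left hsZ y hyY)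
    rw [Finset.insert_erase hsS] at h1
    obtain ⟨S', hS'Z, hS'c, hle⟩ := ih (insert y (S.erase s))
      (by rw [Finset.card_insert_of_notMem hyS, hc])
      (by
        intro x hx
        rcases Finset.mem_insert.1 hx with rfl | hx
        exacts [hYD _ hyY, hsub x hx])
      (by
        intro x hx
        rcases Finset.mem_insert.1 hx with rfl | hx
        exacts [Or.inl (hYZ hyY), hSY x (Finset.mem_of_mem_erase hx)])
      (by
        rw [Finset.insert_sdiff_of_mem _ (hYZ hyY), Finset.erase_sdiff_comm,
          Finset.card_erase_of_mem hs, hN]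
        rfl)
    exact ⟨S', hS'Z, hS'c, h1.trans hle⟩

/-- `Z` has finitely many subsets, so the sum of `|G|` over all of them is a uniform bound. -/
theorem exists_bound_of_replace {G : Finset ℝ → ℝ} {D : Set ℝ} {r : ℝ → ℝ → Prop} {k : ℕ}
    (hG : ∀ (S : Finset ℝ) (a b : ℝ), S.card = k → (∀ x ∈ S, x ∈ D) → a ∈ D → b ∈ D →
      a ∉ S → b ∉ S → r a b → G (insert a S) ≤ G (insert b S))
    {Y Z : Finset ℝ} (hYZ : Y ⊆ Z) (hY : Y.card = k + 1) (hYD : ∀ y ∈ Y, y ∈ D) :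
    ∃ B, ∀ S : Finset ℝ, S.card = k + 1 → (∀ x ∈ S, x ∈ D) →
      (∀ x ∈ S, x ∈ Z ∨ ∀ y ∈ Y, r x y) → G S ≤ B := by
  refine ⟨∑ T ∈ Z.powerset, |G T|, fun S hS hSD hSY => ?_⟩
  obtain ⟨S', hS'Z, -, hle⟩ := exists_le_of_replace hG hYZ hY hYD S hS hSD hSY
  exact hle.trans ((le_abs_self _).trans (Finset.single_le_sum (f := fun T => |G T|)
    (fun _ _ => abs_nonneg _) (Finset.mem_powerset.2 hS'Z)))

/-- For an upper bound, push points upwards into a fixed set `Y` between `b` and `1`; the point `1`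
cannot move up, so it is adjoined to the allowed set. The lower bound mirrors this, with `Y'`
between `-1` and `a`, and `-1` adjoined. -/
theorem IsNConvexOn.exists_abs_finsetDividedDiff_le {m : ℕ} {f : ℝ → ℝ}
    (hf : IsNConvexOn m (Set.Icc (-1) 1) f) {a b : ℝ} (ha : -1 < a) (hb : b < 1) :
    ∃ B, ∀ S : Finset ℝ, S.card = m + 1 → (∀ x ∈ S, x ∈ Set.Icc (-1 : ℝ) 1) →
      (∀ x ∈ S, x = -1 ∨ x = 1 ∨ x ∈ Set.Icc a b) → |finsetDividedDiff f S| ≤ B := by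
  obtain ⟨Y, hY, hYc⟩ := (Set.Ioo_infinite (max_lt (by norm_num : (-1 : ℝ) < 1) hb)
    ).exists_subset_card_eq (m + 1)
  obtain ⟨Y', hY', hYc'⟩ := (Set.Ioo_infinite (lt_min (by norm_num : (-1 : ℝ) < 1) ha)
    ).exists_subset_card_eq (m + 1)
  have hYm : ∀ y ∈ Y, -1 < y ∧ b < y ∧ y < 1 := fun y hy =>
    ⟨(max_lt_iff.1 (hY hy).1).1, (max_lt_iff.1 (hY hy).1).2, (hY hy).2⟩
  have hYm' : ∀ y ∈ Y', -1 < y ∧ y < a ∧ y < 1 := fun y hy =>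
    ⟨(hY' hy).1, (lt_min_iff.1 (hY' hy).2).2, (lt_min_iff.1 (hY' hy).2).1⟩
  obtain ⟨B, hB⟩ := exists_bound_of_replace (G := finsetDividedDiff f) (r := (· < ·))
    (fun S a b h1 h2 h3 h4 h5 h6 h7 => hf.finsetDividedDiff_insert_le h1 h2 h3 h4 h5 h6 h7)
    (Finset.subset_insert 1 Y) hYc (fun y hy => ⟨(hYm y hy).1.le, (hYm y hy).2.2.le⟩)
  obtain ⟨B', hB'⟩ := exists_bound_of_replace (G := fun S => -finsetDividedDiff f S)
    (r := (· > ·))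
    (fun S a b h1 h2 h3 h4 h5 h6 h7 =>
      neg_le_neg (hf.finsetDividedDiff_insert_le h1 h2 h4 h3 h6 h5 h7))
    (Finset.subset_insert (-1) Y') hYc' (fun y hy => ⟨(hYm' y hy).1.le, (hYm' y hy).2.2.le⟩)
  refine ⟨max B B', fun S hS hSI hSab => abs_le.2 ⟨?_, ?_⟩⟩
  · refine neg_le.1 ((hB' S hS hSI fun x hx => ?_).trans (le_max_right _ _))
    rcases hSab x hx with rfl | rfl | h
    · simp
    · exact Or.inr fun y hy => (hYm' y hy).2.2
    · exact Or.inr fun y hy => (hYm' y hy).2.1.trans_le h.1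
  · refine (hB S hS hSI fun x hx => ?_).trans (le_max_left _ _)
    rcases hSab x hx with rfl | rfl | h
    · exact Or.inr fun y hy => (hYm y hy).1
    · simp
    · exact Or.inr fun y hy => h.2.trans_lt (hYm y hy).2.1

/-- Fix `m` interior points `T`. Off `T`, `f` is its interpolant on `T` plus the node polynomial
times `g`, the divided difference with one moving node. This `g` is monotone, and bounded by its
values at `±1`, which are not in `T`. -/
theorem IsNConvexOn.intervalIntegrable {m : ℕ} {f : ℝ → ℝ}
    (hf : IsNConvexOn m (Set.Icc (-1) 1) f) :
    IntervalIntegrable f MeasureTheory.volume (-1) 1 := by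
  obtain ⟨T, hT, hTc⟩ := (Set.Ioo_infinite (by norm_num : (-1 : ℝ) < 1)).exists_subset_card_eq m
  have hTI : ∀ x ∈ T, x ∈ Set.Icc (-1 : ℝ) 1 := fun x hx => Set.Ioo_subset_Icc_self (hT hx)
  set s : Set ℝ := Set.Icc (-1) 1 \ T with hs
  have hsm : MeasurableSet s := measurableSet_Icc.diff T.finite_toSet.measurableSet
  have hae : s =ᵐ[MeasureTheory.volume] Set.Icc (-1 : ℝ) 1 :=
    MeasureTheory.sdiff_null_ae_eq_self (T.finite_toSet.measure_zero _)
  set g : ℝ → ℝ := fun x => finsetDividedDiff f (insert x T) with hg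
  have hmono : MonotoneOn g s := by
    intro x hx y hy hxy
    rcases hxy.eq_or_lt with rfl | hlt
    · exact le_rfl
    · exact hf.finsetDividedDiff_insert_le hTc hTI hx.1 hy.1 hx.2 hy.2 hlt
  have hm1 : (-1 : ℝ) ∈ s := ⟨by norm_num, fun h => lt_irrefl _ (hT h).1⟩
  have h1 : (1 : ℝ) ∈ s := ⟨by norm_num, fun h => lt_irrefl _ (hT h).2⟩
  have hfin : MeasureTheory.volume s ≠ ⊤ := by
    rw [MeasureTheory.measure_congr hae]
    simp
  have hgi : MeasureTheory.IntegrableOn g s := by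
    refine MeasureTheory.IntegrableOn.of_bound hfin.lt_top
      (aemeasurable_restrict_of_monotoneOn hsm hmono).aestronglyMeasurable
      (max |g (-1)| |g 1|) ?_
    filter_upwards [MeasureTheory.ae_restrict_mem hsm] with x hx
    exact abs_le_max_abs_abs (hmono hm1 hx hx.1.1) (hmono hx h1 hx.1.2)
  have hfi : MeasureTheory.IntegrableOn f s := by
    have hI : MeasureTheory.IntegrableOn (fun x => (Lagrange.interpolate T id f).eval x +
        g x * (nodePoly T).eval x) s := by
      have hc : ∀ p : ℝ[X], MeasureTheory.IntegrableOn (fun x => p.eval x) s := fun p =>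
        (p.continuous.continuousOn.integrableOn_Icc).mono_set Set.sdiff_subset
      refine MeasureTheory.Integrable.add (hc _) ?_
      refine MeasureTheory.Integrable.mul_bdd
        (c := ∏ y ∈ T, 2) hgi (nodePoly T).continuous.aestronglyMeasurable ?_
      filter_upwards [MeasureTheory.ae_restrict_mem hsm] with x hx
      rw [nodePoly, Lagrange.eval_nodal, Real.norm_eq_abs, Finset.abs_prod]
      refine Finset.prod_le_prod (fun _ _ => abs_nonneg _) fun y hy => abs_le.2 ?_
      have hy' := hTI y hy
      simp only [id]
      exact ⟨by linarith [hx.1.1, hy'.2], by linarith [hx.1.2, hy'.1]⟩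
    refine hI.congr_fun (fun x hx => ?_) hsm
    have := sub_eval_interpolate f (S := T) (x := x) hx.2
    simp only [nodePoly, Lagrange.eval_nodal, id]
    linarith
  rw [intervalIntegrable_iff_integrableOn_Icc_of_le (by norm_num)]
  exact hfi.congr_set_ae hae.symm

/-! ### Reflection -/

theorem dividedDiff_neg_comp_neg (f : ℝ → ℝ) (k : ℕ) (x : Fin (k + 1) → ℝ) :
    dividedDiff (fun t => -f (-t)) k x = (-1) ^ (k + 1) * dividedDiff f k (fun i => -x i) := by
  induction k with
  | zero => simp [dividedDiff]
  | succ k ih =>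
    simp only [dividedDiff, ih]
    rw [← neg_sub (-x _), neg_sub_neg, ← neg_sub (x _), div_neg, neg_sub]
    ring

/-- Reflection and negation together multiply a divided difference on `2n + 2` points by
`(-1)^(2n+2) = 1`. -/
theorem IsNConvexOn.neg_comp_neg {n : ℕ} {f : ℝ → ℝ}
    (hf : IsNConvexOn (2 * n) (Set.Icc (-1) 1) f) :
    IsNConvexOn (2 * n) (Set.Icc (-1) 1) (fun t => -f (-t)) := by
  intro x hx hxs
  have h : (-1 : ℝ) ^ (2 * n + 1 + 1) = 1 := by
    rw [show 2 * n + 1 + 1 = 2 * (n + 1) by ring, pow_mul, neg_one_sq, one_pow]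
  rw [dividedDiff_neg_comp_neg, h, one_mul]
  exact hf _ (neg_injective.comp hx) fun i =>
    ⟨by linarith [(hxs i).2], by linarith [(hxs i).1]⟩

/-! ### One-sided bounds by splitting double nodes -/

/-- For a finite set of points in `(-1, 1)`, all small shifts to the right stay in a fixed compact
subinterval and avoid the points of the set. -/
theorem eventually_shift {I : Finset ℝ} (hI : ∀ x ∈ I, x ∈ Set.Ioo (-1 : ℝ) 1) :
    ∃ a b : ℝ, -1 < a ∧ b < 1 ∧ (∀ x ∈ I, x ∈ Set.Icc a b) ∧
      ∀ᶠ ε in 𝓝[>] (0 : ℝ), ∀ x ∈ I, x + ε ∈ Set.Icc a b ∧ ∀ y ∈ I, x + ε ≠ y := by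
  -- The margin `2 * δ` on the right leaves room for shifts smaller than δ inside `[-1 + δ, 1 - δ]`.
  have h1 : ∀ᶠ δ in 𝓝[>] (0 : ℝ), ∀ x ∈ I, x ∈ Set.Icc (-1 + δ) (1 - 2 * δ) := by
    refine (Finset.eventually_all I).2 fun x hx => ?_
    have hpos : 0 < min (x + 1) ((1 - x) / 2) :=
      lt_min (by linarith [(hI x hx).1]) (by linarith [(hI x hx).2])
    filter_upwards [Ioo_mem_nhdsGT hpos] with δ hδ
    have := lt_min_iff.1 hδ.2
    exact ⟨by linarith, by linarith⟩
  obtain ⟨δ, hδ, hδ0⟩ := (h1.and self_mem_nhdsWithin).exists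
  have hδ0 : 0 < δ := hδ0
  refine ⟨-1 + δ, 1 - δ, by linarith, by linarith,
    fun x hx => ⟨(hδ x hx).1, by linarith [(hδ x hx).2]⟩, ?_⟩
  refine (Finset.eventually_all I).2 fun x hx => ?_
  have h2 : ∀ᶠ ε in 𝓝[>] (0 : ℝ), ∀ y ∈ I, x + ε ≠ y := by
    refine (Finset.eventually_all I).2 fun y _ => ?_
    rcases le_or_gt y x with hyx | hxy
    · filter_upwards [self_mem_nhdsWithin] with ε hε
      have hε : 0 < ε := hε
      linarith
    · filter_upwards [Ioo_mem_nhdsGT (sub_pos.2 hxy)] with ε hε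
      linarith [hε.2]
  filter_upwards [h2, Ioo_mem_nhdsGT hδ0] with ε hε hεδ
  exact ⟨⟨by linarith [(hδ x hx).1, hεδ.1], by linarith [(hδ x hx).2, hεδ.2]⟩, hε⟩

/-- The divided difference on `T` and `x` need not stay bounded as nodes merge, but its product with
`x - t₀` is a difference of two divided differences on `m + 1` points, hence at most `2 * B` in
absolute value. Each of the `m` remaining factors is at most 2. -/
theorem abs_sub_eval_interpolate_le {f : ℝ → ℝ} {m : ℕ} {B a b x t₀ : ℝ} {T : Finset ℝ}
    (hB : ∀ S : Finset ℝ, S.card = m + 1 → (∀ x ∈ S, x ∈ Set.Icc (-1 : ℝ) 1) →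
      (∀ x ∈ S, x = -1 ∨ x = 1 ∨ x ∈ Set.Icc a b) → |finsetDividedDiff f S| ≤ B)
    (hT : T.card = m + 1) (hTI : ∀ t ∈ T, t ∈ Set.Icc (-1 : ℝ) 1)
    (hTab : ∀ t ∈ T, t = -1 ∨ t = 1 ∨ t ∈ Set.Icc a b) (hx : x ∈ Set.Icc (-1 : ℝ) 1)
    (hxab : x ∈ Set.Icc a b) (hxT : x ∉ T) (ht₀ : t₀ ∈ T) :
    |f x - (Lagrange.interpolate T id f).eval x| ≤ 2 * B * 2 ^ m := by
  have hxe : x ∉ T.erase t₀ := fun h => hxT (Finset.mem_of_mem_erase h)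
  have hne : x ≠ t₀ := fun h => hxT (h ▸ ht₀)
  have hc : (T.erase t₀).card = m := by rw [Finset.card_erase_of_mem ht₀, hT]; rfl
  have h1 := finsetDividedDiff_insert_sub f hxe (Finset.notMem_erase t₀ T) hne
  rw [Finset.insert_erase ht₀] at h1
  have hins : ∀ P : ℝ → Prop, P x → (∀ t ∈ T, P t) → ∀ t ∈ insert x (T.erase t₀), P t := by
    intro P hPx hP t ht
    rcases Finset.mem_insert.1 ht with rfl | ht
    exacts [hPx, hP t (Finset.mem_of_mem_erase ht)]
  have hB1 := hB T hT hTI hTab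
  have hB2 := hB (insert x (T.erase t₀)) (by rw [Finset.card_insert_of_notMem hxe, hc])
    (hins _ hx hTI) (hins _ (Or.inr (Or.inr hxab)) hTab)
  have hprod : |∏ y ∈ T.erase t₀, (x - y)| ≤ 2 ^ m := by
    rw [Finset.abs_prod, ← hc, ← Finset.prod_const]
    refine Finset.prod_le_prod (fun _ _ => abs_nonneg _) fun y hy => abs_le.2 ?_
    have hy' := hTI y (Finset.mem_of_mem_erase hy)
    exact ⟨by linarith [hx.1, hy'.2], by linarith [hx.2, hy'.1]⟩
  rw [sub_eval_interpolate f hxT, ← Finset.mul_prod_erase T _ ht₀,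
    show finsetDividedDiff f (insert x T) * ((x - t₀) * ∏ y ∈ T.erase t₀, (x - y)) =
      (finsetDividedDiff f (insert x (T.erase t₀)) - finsetDividedDiff f T) *
        ∏ y ∈ T.erase t₀, (x - y) by linear_combination (∏ y ∈ T.erase t₀, (x - y)) * h1,
    abs_mul]
  refine mul_le_mul ((abs_sub _ _).trans (by linarith)) hprod (abs_nonneg _) ?_
  linarith [abs_nonneg (finsetDividedDiff f T)]

theorem sum_integral_indicator_Ioo {I : Finset ℝ} {ε : ℝ} (hε : 0 < ε)
    (hI : ∀ i ∈ I, i ∈ Set.Ioo (-1 : ℝ) 1 ∧ i + ε ≤ 1) :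
    IntervalIntegrable (fun x => ∑ i ∈ I, (Set.Ioo i (i + ε)).indicator (fun _ => (1 : ℝ)) x)
      MeasureTheory.volume (-1) 1 ∧
    ∫ x in (-1 : ℝ)..1, ∑ i ∈ I, (Set.Ioo i (i + ε)).indicator (fun _ => (1 : ℝ)) x =
      I.card * ε := by
  have hint : ∀ i ∈ I, IntervalIntegrable
      ((Set.Ioo i (i + ε)).indicator (fun _ => (1 : ℝ))) MeasureTheory.volume (-1) 1 := by
    intro i _
    rw [intervalIntegrable_iff_integrableOn_Ioc_of_le (by norm_num)]
    exact (MeasureTheory.integrable_const (1 : ℝ)).indicator measurableSet_Ioo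
  refine ⟨?_, ?_⟩
  · have := IntervalIntegrable.sum I hint
    rwa [Finset.sum_fn] at this
  · rw [intervalIntegral.integral_finsetSum hint, Finset.sum_congr rfl, Finset.sum_const,
      nsmul_eq_mul]
    intro i hi
    rw [intervalIntegral.integral_of_le (by norm_num),
      MeasureTheory.setIntegral_indicator measurableSet_Ioo,
      Set.inter_eq_self_of_subset_right (show Set.Ioo i (i + ε) ⊆ Set.Ioc (-1) 1 from
        fun x hx => ⟨(hI i hi).1.1.trans hx.1, hx.2.le.trans (hI i hi).2⟩)]
    simp [hε.le]

/-- A quadrature with simple nodes `E ⊆ {-1, 1}` and `I ⊆ (-1, 1)`, exact on polynomials of degree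
at most `m = #E + 2 #I - 1`, bounds the integral of an `m`-convex function from the side given by
the sign of `∏ e ∈ E, (x - e)`. -/
theorem IsNConvexOn.quadrature_le {m : ℕ} {f : ℝ → ℝ}
    (hf : IsNConvexOn m (Set.Icc (-1) 1) f) {E I : Finset ℝ} (hE : ∀ x ∈ E, x = -1 ∨ x = 1)
    (hI : ∀ x ∈ I, x ∈ Set.Ioo (-1 : ℝ) 1) (hcard : E.card + 2 * I.card = m + 1) {σ : ℝ}
    (hσ : |σ| = 1) (hσE : ∀ x ∈ Set.Icc (-1 : ℝ) 1, 0 ≤ σ * ∏ e ∈ E, (x - e)) (w : ℝ → ℝ)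
    (hw : ∀ p : ℝ[X], p.degree < (m + 1 : ℕ) →
      polyIntegral p = ∑ x ∈ E ∪ I, w x * p.eval x) :
    σ * ∑ x ∈ E ∪ I, w x * f x ≤ σ * ∫ x in (-1 : ℝ)..1, f x := by
  obtain ⟨a, b, ha, hb, hIab, hev⟩ := eventually_shift hI
  obtain ⟨B, hB⟩ := hf.exists_abs_finsetDividedDiff_le ha hb
  have hfi := hf.intervalIntegrable
  set C := 2 * B * 2 ^ m with hC
  have key : ∀ᶠ ε in 𝓝[>] (0 : ℝ), -(C * (I.card * ε)) ≤
      σ * ((∫ x in (-1 : ℝ)..1, f x) - ∑ x ∈ E ∪ I, w x * f x) := by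
    filter_upwards [hev, self_mem_nhdsWithin] with ε hεI hε
    have hε : 0 < ε := hε
    -- The shifted copies stand in for the second half of each double node; with them `T` has
    -- exactly `m + 1` points.
    set I' : Finset ℝ := I.image (· + ε) with hI'
    have habs : ∀ x ∈ Set.Icc a b, x ∈ Set.Icc (-1 : ℝ) 1 :=
      fun x hx => ⟨by linarith [hx.1], by linarith [hx.2]⟩
    have hI'ab : ∀ x ∈ I', x ∈ Set.Icc a b := by
      intro x hx
      obtain ⟨i, hi, rfl⟩ := Finset.mem_image.1 hx
      exact (hεI i hi).1
    have hE' : ∀ x ∈ Set.Icc a b, x ∉ E := by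
      intro x hx h
      rcases hE x h with rfl | rfl
      · linarith [hx.1]
      · linarith [hx.2]
    have hdisj : Disjoint I I' := by
      rw [Finset.disjoint_right]
      intro x hx hxI
      obtain ⟨i, hi, rfl⟩ := Finset.mem_image.1 hx
      exact (hεI i hi).2 _ hxI rfl
    have hdisjE : Disjoint E (I ∪ I') := by
      rw [Finset.disjoint_right]
      intro x hx
      rcases Finset.mem_union.1 hx with hx | hx
      exacts [hE' x (hIab x hx), hE' x (hI'ab x hx)]
    have hI'card : I'.card = I.card := Finset.card_image_of_injective _ (add_left_injective ε)
    set T := E ∪ (I ∪ I') with hT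
    have hTc : T.card = m + 1 := by
      rw [hT, Finset.card_union_of_disjoint hdisjE, Finset.card_union_of_disjoint hdisj, hI'card]
      omega
    have hTab : ∀ t ∈ T, t = -1 ∨ t = 1 ∨ t ∈ Set.Icc a b := by
      intro t ht
      rcases Finset.mem_union.1 ht with ht | ht
      · rcases hE t ht with h | h
        exacts [Or.inl h, Or.inr (Or.inl h)]
      · rcases Finset.mem_union.1 ht with ht | ht
        exacts [Or.inr (Or.inr (hIab t ht)), Or.inr (Or.inr (hI'ab t ht))]
    have hTI : ∀ t ∈ T, t ∈ Set.Icc (-1 : ℝ) 1 := by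
      intro t ht
      rcases hTab t ht with rfl | rfl | h
      · norm_num
      · norm_num
      · exact habs t h
    set p := Lagrange.interpolate T id f with hp
    have hpT : ∀ t ∈ T, p.eval t = f t := fun t ht =>
      Lagrange.eval_interpolate_at_node f (Set.injOn_id _) ht
    -- The rule sees only `E ∪ I`, where `p` agrees with `f`, so the nodes in `I'` leave its value
    -- unchanged.
    have hJp : polyIntegral p = ∑ x ∈ E ∪ I, w x * f x := by
      rw [hw p (hTc ▸ Lagrange.degree_interpolate_lt f (Set.injOn_id _))]
      refine Finset.sum_congr rfl fun x hx => ?_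
      rw [hpT x (Finset.union_subset_union_right Finset.subset_union_left hx)]
    have hpi : IntervalIntegrable (fun x => p.eval x) MeasureTheory.volume (-1) 1 :=
      p.continuous.intervalIntegrable _ _
    have hind0 : ∀ x, ∀ i ∈ I, 0 ≤ (Set.Ioo i (i + ε)).indicator (fun _ => (1 : ℝ)) x :=
      fun x i _ => Set.indicator_nonneg (fun _ _ => zero_le_one) x
    have hB0 : 0 ≤ C := by
      have := (abs_nonneg _).trans (hB T hTc hTI hTab)
      positivity
    have hpt : ∀ x ∈ Set.Icc (-1 : ℝ) 1,
        -(C * ∑ i ∈ I, (Set.Ioo i (i + ε)).indicator (fun _ => (1 : ℝ)) x) ≤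
          σ * (f x - p.eval x) := by
      intro x hx
      have hsum0 := Finset.sum_nonneg (hind0 x)
      by_cases hxT : x ∈ T
      · rw [hpT x hxT, sub_self, mul_zero, neg_nonpos]
        exact mul_nonneg hB0 hsum0
      by_cases hxI : ∃ i ∈ I, x ∈ Set.Ioo i (i + ε)
      · obtain ⟨i, hi, hxi⟩ := hxI
        have hxab : x ∈ Set.Icc a b :=
          ⟨(hIab i hi).1.trans hxi.1.le, hxi.2.le.trans (hεI i hi).1.2⟩
        have h1 := abs_sub_eval_interpolate_le hB hTc hTI hTab hx hxab hxT
          (Finset.mem_union_right _ (Finset.mem_union_left _ hi))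
        have h2 : (1 : ℝ) ≤ ∑ i ∈ I, (Set.Ioo i (i + ε)).indicator (fun _ => (1 : ℝ)) x := by
          have := Finset.single_le_sum (hind0 x) hi
          rwa [Set.indicator_of_mem hxi] at this
        have h3 : |σ * (f x - p.eval x)| ≤ C := by rwa [abs_mul, hσ, one_mul]
        have h4 := le_mul_of_one_le_right hB0 h2
        linarith [(abs_le.1 h3).1]
      · have h1 : 0 ≤ σ * (f x - p.eval x) := by
          rw [sub_eval_interpolate f hxT, hT, Finset.prod_union hdisjE, Finset.prod_union hdisj,
            hI', Finset.prod_image (fun _ _ _ _ h => add_left_injective ε h),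
            ← Finset.prod_mul_distrib]
          have h2 : 0 ≤ finsetDividedDiff f (insert x T) := by
            refine hf.finsetDividedDiff_nonneg (by
              rw [Finset.card_insert_of_notMem hxT, hTc]) fun t ht => ?_
            rcases Finset.mem_insert.1 ht with rfl | ht
            exacts [hx, hTI t ht]
          -- As `x` lies in no interval `(i, i + ε)`, both factors of each pair have the same sign,
          -- as a true square would give.
          have h3 : 0 ≤ ∏ i ∈ I, (x - i) * (x - (i + ε)) := by
            refine Finset.prod_nonneg fun i hi => ?_
            rcases le_or_gt x i with h | h
            · exact mul_nonneg_of_nonpos_of_nonpos (by linarith) (by linarith)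
            · have : i + ε ≤ x := not_lt.1 fun h' => hxI ⟨i, hi, h, h'⟩
              exact mul_nonneg (by linarith) (by linarith)
          have := mul_nonneg h2 (mul_nonneg (hσE x hx) h3)
          linarith
        exact (neg_nonpos.2 (mul_nonneg hB0 hsum0)).trans h1
    obtain ⟨hi1, hi2⟩ := sum_integral_indicator_Ioo hε fun i hi =>
      ⟨hI i hi, (habs _ (hεI i hi).1).2⟩
    have hle := intervalIntegral.integral_mono_on (by norm_num : (-1 : ℝ) ≤ 1)
      (hi1.const_mul C).neg ((hfi.sub hpi).const_mul σ) hpt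
    simp only [Pi.neg_apply] at hle
    rw [intervalIntegral.integral_neg, intervalIntegral.integral_const_mul, hi2,
      intervalIntegral.integral_const_mul, intervalIntegral.integral_sub hfi hpi,
      ← polyIntegral_apply, hJp] at hle
    exact hle
  have hlim : Tendsto (fun ε : ℝ => -(C * (I.card * ε))) (𝓝[>] 0) (𝓝 0) := by
    have : Continuous fun ε : ℝ => -(C * (I.card * ε)) := by fun_prop
    simpa using (this.tendsto 0).mono_left nhdsWithin_le_nhds
  have := le_of_tendsto hlim key
  rw [mul_sub] at this
  linarith

/-! ### The four inequalities -/

theorem IsNConvexOn.gauss_le {n : ℕ} (hn : 1 ≤ n) {f : ℝ → ℝ}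
    (hf : IsNConvexOn (2 * n - 1) (Set.Icc (-1) 1) f) :
    gauss n f ≤ ∫ x in (-1 : ℝ)..1, f x := by
  have h := hf.quadrature_le (E := ∅) (I := (legendreP n).roots.toFinset) (σ := 1) (by simp)
    (fun x hx => mem_Ioo_of_isRoot_legendreP
      (isRoot_of_mem_roots (Multiset.mem_toFinset.1 hx)))
    (by rw [card_roots_legendreP, Finset.card_empty]; omega) (by simp) (by simp)
    (fun x => 2 * (1 - x ^ 2) / (((n : ℝ) + 1) ^ 2 * (legendreP (n + 1)).eval x ^ 2))
    (fun p hp => by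
      rw [Finset.empty_union]
      exact polyIntegral_eq_gauss n p (by rwa [show 2 * n - 1 + 1 = 2 * n by omega] at hp))
  rwa [one_mul, one_mul, Finset.empty_union] at h

theorem IsNConvexOn.le_lobatto {n : ℕ} (hn : 1 ≤ n) {f : ℝ → ℝ}
    (hf : IsNConvexOn (2 * n - 1) (Set.Icc (-1) 1) f) :
    ∫ x in (-1 : ℝ)..1, f x ≤ lobatto (n + 1) f := by
  have hun : ({-1, 1} : Finset ℝ) ∪ (derivative (legendreP n)).roots.toFinset =
      insert (-1) (insert 1 (derivative (legendreP n)).roots.toFinset) := by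
    ext; simp
  have h11 : (-1 : ℝ) ∉ ({1} : Finset ℝ) := by norm_num
  have h := hf.quadrature_le (E := {-1, 1}) (I := (derivative (legendreP n)).roots.toFinset)
    -- On `[-1, 1]` the product `(x + 1)(x - 1)` is nonpositive, so the inequality is reversed
    -- compared with Gauss.
    (σ := -1) (by simp)
    (fun x hx => mem_Ioo_of_isRoot_derivative_legendreP hn
      (isRoot_of_mem_roots (Multiset.mem_toFinset.1 hx)))
    (by
      rw [card_roots_derivative_legendreP hn, Finset.card_insert_of_notMem h11,
        Finset.card_singleton]
      omega)
    (by simp)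
    (fun x hx => by
      rw [Finset.prod_insert h11, Finset.prod_singleton]
      nlinarith [hx.1, hx.2])
    (lobattoWeight n)
    (fun p hp => by
      rw [hun, ← lobatto_succ_eq_sum hn fun x => p.eval x]
      exact polyIntegral_eq_lobatto n hn p (by rwa [show 2 * n - 1 + 1 = 2 * n by omega] at hp))
  rw [hun, ← lobatto_succ_eq_sum hn] at h
  linarith

theorem IsNConvexOn.radauLeft_le {n : ℕ} {f : ℝ → ℝ}
    (hf : IsNConvexOn (2 * n) (Set.Icc (-1) 1) f) :
    radauLeft (n + 1) f ≤ ∫ x in (-1 : ℝ)..1, f x := by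
  have hun : ({-1} : Finset ℝ) ∪ (radauPoly (n + 1)).roots.toFinset =
      insert (-1) (radauPoly (n + 1)).roots.toFinset := rfl
  have h := hf.quadrature_le (E := {-1}) (I := (radauPoly (n + 1)).roots.toFinset) (σ := 1)
    (by simp)
    (fun x hx => mem_Ioo_of_isRoot_radauPoly (isRoot_of_mem_roots (Multiset.mem_toFinset.1 hx)))
    (by rw [card_roots_radauPoly, Finset.card_singleton]; omega)
    (by simp)
    (fun x hx => by
      rw [Finset.prod_singleton]
      linarith [hx.1])
    (radauWeight n)
    (fun p hp => by
      rw [hun, ← radauLeft_succ_eq_sum n fun x => p.eval x]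
      exact polyIntegral_eq_radauLeft n p hp)
  rwa [one_mul, one_mul, hun, ← radauLeft_succ_eq_sum] at h

/-- Apply the left Radau bound to `-f(-x)`, again `2n`-convex; the integral and the rule both change
sign, reversing the inequality. -/
theorem IsNConvexOn.le_radauRight {n : ℕ} {f : ℝ → ℝ}
    (hf : IsNConvexOn (2 * n) (Set.Icc (-1) 1) f) :
    ∫ x in (-1 : ℝ)..1, f x ≤ radauRight (n + 1) f := by
  have h := hf.neg_comp_neg.radauLeft_le
  have h1 : radauLeft (n + 1) (fun t => -f (-t)) = -radauRight (n + 1) f := by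
    simp only [radauRight, radauLeft_succ_eq_sum, mul_neg, Finset.sum_neg_distrib]
  rw [h1, intervalIntegral.integral_neg, intervalIntegral.integral_comp_neg, neg_neg] at h
  linarith

end Quadrature

theorem mainTheorem4 (n : ℕ) (hn : 1 ≤ n) (f : ℝ → ℝ) :
    (Quadrature.IsNConvexOn (2 * n - 1) (Set.Icc (-1) 1) f →
      IntervalIntegrable f MeasureTheory.volume (-1) 1 ∧
        Quadrature.gauss n f ≤ (∫ x in (-1 : ℝ)..1, f x) ∧
        (∫ x in (-1 : ℝ)..1, f x) ≤ Quadrature.lobatto (n + 1) f) ∧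
    (Quadrature.IsNConvexOn (2 * n) (Set.Icc (-1) 1) f →
      IntervalIntegrable f MeasureTheory.volume (-1) 1 ∧
        Quadrature.radauLeft (n + 1) f ≤ (∫ x in (-1 : ℝ)..1, f x) ∧
        (∫ x in (-1 : ℝ)..1, f x) ≤ Quadrature.radauRight (n + 1) f) := by
  exact ⟨fun hf => ⟨hf.intervalIntegrable, hf.gauss_le hn, hf.le_lobatto hn⟩,
    fun hf => ⟨hf.intervalIntegrable, hf.radauLeft_le, hf.le_radauRight⟩⟩
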